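/- Let $k\ge 2$, let $\mathscr M\subset\mathbb R^k$ be open, and let $(X_t)_{t\ge 0}$ be a (time-homogeneous, conservative) strong Markov process with càdlàg sample paths in $\mathscr M$: on one probability space with probability $\mathbb P$, $X_t(z)$ denotes its position at time $t$ when it starts at $z\in\mathscr M$, and $\mathbb P_z$, $\mathbb E_z$ refer to the law of $(X_t(z))_{t\ge0}$. Let $V:\mathscr M\to\mathbb R$ be continuous and bounded from below, and assume that for all $z\in\mathscr M$ and $t\ge0$ the integral $\int_0^t V(X_s(z))\,ds$ is almost surely finite. For a Borel set $A$, let $b\mathcal B(A)$ be the set of bounded Borel functions $A\to\mathbb R$. Assume that: - $[\mathrm{SF}_0]$ for every $t>0$ and $f\in b\mathcal B(\mathscr M)$, the map $z\in\mathscr M\mapsto \mathbb E_z[f(X_t)]$ is continuous; - $[\mathrm P_{t=s}]$ for every $t\ge 0$, the map $z\in\mathscr M\mapsto X_t(z)$ is continuous in $\mathbb P$-probability; - $[\mathrm D_e]$ for every $t>0$ and $z\in\mathscr M$, the law of $X_t(z)$ has a density with respect to the Lebesgue measure; - $[IV]$ for every $t\ge 0$ and all $z_n\to z$ in $\mathscr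 M$, $\int_0^t V(X_s(z_n))\,ds\to\int_0^t V(X_s(z))\,ds$ in $\mathbb P$-probability. Then the non-killed Feynman–Kac semigroup is strongly Feller: for every $t>0$ and $f\in b\mathcal B(\mathscr M)$, the map $$z\in\mathscr M\mapsto \mathbb E_z\Big[f(X_t)\,e^{-\int_0^tV(X_s)ds}\Big]$$ is continuous. Let moreover $\mathscr V\subset\mathscr M$ be a subdomain (a nonempty, connected, open subset), let $\sigma_{\mathscr V}=\inf\{t\ge0: X_t\notin\mathscr V\}$, and assume in addition that - $[\mathrm B]$ for every compact subset $K$ of $\mathscr V$, $\lim_{s\to0^+}\sup_{z\in K}\mathbb P_z[\sigma_{\mathscr V}\le s]=0$. Then the killed Feynman–Kac semigroup is strongly Feller: for every $t>0$ and $f\in b\mathcal B(\mathscr V)$, the map $$z\in\mathscr V\mapsto \mathbb E_z\Big[f(X_t)\,e^{-\int_0^tV(X_s)ds}\,\mathbf 1_{t<\sigma_{\mathscr V}}\Big]$$ is continuous. -/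

import Mathlib

open MeasureTheory ProbabilityTheory Filter Topology Set
open scoped NNReal ENNReal

namespace FeynmanKac

/-- Bounded Borel functions on a space. -/
def IsBoundedMeasurable {S : Type*} [MeasurableSpace S] (f : S → ℝ) : Prop :=
  Measurable f ∧ ∃ C : ℝ, ∀ x, |f x| ≤ C

/-- Càdlàg paths: right-continuous at every time, with a left limit in `S` at every time
(the condition on the left limit is void at time `0`). -/
def IsCadlag {S : Type*} [TopologicalSpace S] (x : ℝ≥0 → S) : Prop :=
  ∀ t : ℝ≥0, ContinuousWithinAt x (Ici t) t ∧ ∃ l : S, Tendsto x (𝓝[<] t) (𝓝 l)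

/-- The law of the whole path of `X`, as a measure on the path space `S ^ [0, ∞)` with the
product `σ`-algebra. -/
noncomputable def pathLaw {Ω S : Type*} [MeasurableSpace Ω] [MeasurableSpace S]
    (P : Measure Ω) (X : ℝ≥0 → Ω → S) : Measure (ℝ≥0 → S) :=
  P.map (fun ω t => X t ω)

/-- `X z t` is the position at time `t` of the process started at `z`; all these processes live on
one probability space, and `𝓕 z` is a filtration for the process started at `z`. They form
a (time-homogeneous, conservative) strong Markov process with càdlàg paths in `S`; the law
`ℙ_z` of the process started at `z` is `pathLaw P (X z)`. -/
structure IsCadlagStrongMarkov {Ω S : Type*} [mΩ : MeasurableSpace Ω] [MeasurableSpace S]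
    [TopologicalSpace S] (P : Measure Ω) (𝓕 : S → Filtration ℝ≥0 mΩ)
    (X : S → ℝ≥0 → Ω → S) : Prop where
  adapted : ∀ z t, Measurable[𝓕 z t] (X z t)
  start : ∀ z, ∀ᵐ ω ∂P, X z 0 ω = z
  cadlag : ∀ z, ∀ᵐ ω ∂P, IsCadlag (fun t => X z t ω)
  measurable_law : Measurable (fun z => pathLaw P (X z))
  /-- For every start point `z`, every stopping time `τ`, every event `G` of the past of `τ` and
  every event `A` of the path space,
  `P (G, τ < ∞, X_{τ + ·}(z) ∈ A) = E [1_{G, τ < ∞} ℙ_{X_τ(z)} (A)]`. -/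
  strong_markov : ∀ (z : S) (τ : Ω → WithTop ℝ≥0) (hτ : IsStoppingTime (𝓕 z) τ)
    (G : Set Ω), MeasurableSet[hτ.measurableSpace] G →
    ∀ A : Set (ℝ≥0 → S), MeasurableSet A →
      P {ω | ω ∈ G ∧ τ ω ≠ ⊤ ∧ (fun u : ℝ≥0 => X z ((τ ω).untopD 0 + u) ω) ∈ A}
        = ∫⁻ ω in {ω | ω ∈ G ∧ τ ω ≠ ⊤}, pathLaw P (X (X z ((τ ω).untopD 0) ω)) A ∂P

/-- The integral of the potential along the path started at `z`, `∫₀ᵗ V (X_s(z)) ds`. -/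
noncomputable def potentialIntegral {Ω S : Type*} (X : S → ℝ≥0 → Ω → S) (V : S → ℝ)
    (z : S) (t : ℝ≥0) (ω : Ω) : ℝ :=
  ∫ s in (0 : ℝ)..t, V (X z s.toNNReal ω)

/-- The first exit time `inf {t ≥ 0 : X_t(z) ∉ D}`, equal to `⊤` if there is no such `t`. -/
noncomputable def exitTime {Ω S : Type*} (X : S → ℝ≥0 → Ω → S) (D : Set S) (z : S) :
    Ω → WithTop ℝ≥0 :=
  hittingAfter (X z) Dᶜ 0

/-- The transition semigroup `U_t f (z) = E_z [f (X_t)]`. -/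
noncomputable def transition {Ω S : Type*} [MeasurableSpace Ω] (P : Measure Ω)
    (X : S → ℝ≥0 → Ω → S) (t : ℝ≥0) (f : S → ℝ) (z : S) : ℝ :=
  ∫ ω, f (X z t ω) ∂P

/-- The non-killed Feynman–Kac semigroup `T_t f (z) = E_z [f (X_t) exp (-∫₀ᵗ V (X_s) ds)]`. -/
noncomputable def feynmanKac {Ω S : Type*} [MeasurableSpace Ω] (P : Measure Ω)
    (X : S → ℝ≥0 → Ω → S) (V : S → ℝ) (t : ℝ≥0) (f : S → ℝ) (z : S) : ℝ :=
  ∫ ω, f (X z t ω) * Real.exp (-potentialIntegral X V z t ω) ∂P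

/-- The killed Feynman–Kac semigroup
`Q_t f (z) = E_z [f (X_t) exp (-∫₀ᵗ V (X_s) ds) 1_{t < σ_D}]` for `f` and `z` living on `D`.
The function `f` is extended by `0` outside `D`, which is immaterial since `X_t ∈ D` if
`t < σ_D`. -/
noncomputable def killedFeynmanKac {Ω S : Type*} [MeasurableSpace Ω] (P : Measure Ω)
    (X : S → ℝ≥0 → Ω → S) (V : S → ℝ) (D : Set S) (t : ℝ≥0) (f : D → ℝ) (z : D) : ℝ :=
  ∫ ω, Function.extend Subtype.val f 0 (X z t ω)
    * Real.exp (-potentialIntegral X V z t ω)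
    * Set.indicator {ω' | (t : WithTop ℝ≥0) < exitTime X D z ω'} (fun _ => (1 : ℝ)) ω ∂P

end FeynmanKac

/-! Non-killed semigroup. Let `z_n → z`. Along a subsequence the positions at time `t` and the
integrals of `V` converge almost surely. The strong Feller property says that the laws of the
positions converge setwise. Approximating `f` by a bounded continuous `g` in `L¹` of the limit law,
and transferring the error `|f - g|` to the laws along the sequence by setwise convergence, gives `f
(X_t (z_n)) → f (X_t (z))` in `L¹` (`tendsto_integral_abs_sub_of_setwise`). The weights `exp (-∫ V)`
are at most `exp (c t)` when `V ≥ -c`, so the products converge in expectation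
(`continuous_feynmanKac`).

Killed semigroup. For `0 < s < t`, `T_s (Q_{t-s} f)` ignores the killing during `[0, s)`. By the
Markov property at `s` it differs from `Q_t f (z)` by at most `C exp (c t) ℙ_z (σ ≤ s)`
(`abs_sub_feynmanKac_le`), which tends to `0` uniformly on compact sets as `s → 0`. By the first
part `T_s (Q_{t-s} f)` is continuous, so `Q_t f` is a locally uniform limit of continuous functions.

The Markov property concerns the product `σ`-algebra, whereas the integral and the exit time involve
uncountably many times. They are replaced by the product measurable `weight` and `survival`. For the
exit this is legitimate only if almost no path approaches the complement of the domain without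
reaching it. That is quasi-left-continuity (`ae_exists_eq_zero`): with `T_n ↑ T` the entrance times
into `{φ < 1 / (n + 1)}` and `g = min φ 1`, let first `n → ∞` and then `u → 0` in `E g (X_{T_n + u})
= E U_u g (X_{T_n})`. The result is `E g (X_T) = E g (lim X_{T_n}) = 0`, all on the event of
approach. -/

namespace FeynmanKac

/-! ### Càdlàg paths and their shifts -/

section Paths

variable {S : Type*} [TopologicalSpace S] {x : ℝ≥0 → S}

lemma IsCadlag.continuousWithinAt (hx : IsCadlag x) (t : ℝ≥0) :
    ContinuousWithinAt x (Ici t) t := (hx t).1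

/-- A continuous function is bounded along a càdlàg path on compact time intervals. -/
lemma IsCadlag.exists_bound (hx : IsCadlag x) {V : S → ℝ} (hV : Continuous V) (t : ℝ≥0) :
    ∃ C, ∀ s ≤ t, |V (x s)| ≤ C := by
  have key : ∃ C, ∀ s ∈ Icc 0 t, |V (x s)| ≤ C := by
    -- Local boundedness suffices by compactness; near each time it comes from the two one-sided
    -- limits.
    refine isCompact_Icc.induction_on (p := fun A => ∃ C, ∀ s ∈ A, |V (x s)| ≤ C) ⟨0, by simp⟩
      (fun A B hAB ⟨C, hC⟩ => ⟨C, fun s hs => hC s (hAB hs)⟩) ?_ ?_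
    · rintro A B ⟨C, hC⟩ ⟨C', hC'⟩
      refine ⟨max C C', fun s hs => ?_⟩
      rcases hs with hs | hs
      · exact (hC s hs).trans (le_max_left _ _)
      · exact (hC' s hs).trans (le_max_right _ _)
    · intro s _
      obtain ⟨hr, l, hl⟩ := hx s
      have hVabs : Continuous fun y => |V y| := hV.abs
      have h1 : ∀ᶠ u in 𝓝[≥] s, |V (x u)| < |V (x s)| + 1 :=
        ((hVabs.tendsto _).comp hr).eventually (gt_mem_nhds (lt_add_one _))
      have h2 : ∀ᶠ u in 𝓝[<] s, |V (x u)| < |V l| + 1 :=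
        ((hVabs.tendsto _).comp hl).eventually (gt_mem_nhds (lt_add_one _))
      have h3 : ∀ᶠ u in 𝓝 s, |V (x u)| ≤ max (|V (x s)| + 1) (|V l| + 1) := by
        rw [← nhdsLT_sup_nhdsGE s, eventually_sup]
        exact ⟨h2.mono fun u hu => hu.le.trans (le_max_right _ _),
          h1.mono fun u hu => hu.le.trans (le_max_left _ _)⟩
      exact ⟨_, mem_nhdsWithin_of_mem_nhds h3, _, fun u hu => hu⟩
  obtain ⟨C, hC⟩ := key
  exact ⟨C, fun s hs => hC s ⟨zero_le, hs⟩⟩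

/-- A càdlàg path converges along convergent nondecreasing sequences of times. -/
lemma IsCadlag.exists_tendsto_of_monotone (hx : IsCadlag x) {T : ℕ → ℝ≥0} (hT : Monotone T)
    {L : ℝ≥0} (hL : Tendsto T atTop (𝓝 L)) :
    ∃ l, Tendsto (fun n => x (T n)) atTop (𝓝 l) := by
  have hle : ∀ n, T n ≤ L := hT.ge_of_tendsto hL
  by_cases h : ∃ N, T N = L
  · obtain ⟨N, hN⟩ := h
    refine ⟨x L, tendsto_const_nhds.congr' ?_⟩
    filter_upwards [eventually_ge_atTop N] with n hn
    rw [le_antisymm (hle n) (hN ▸ hT hn)]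
  · push Not at h
    obtain ⟨l, hl⟩ := (hx L).2
    refine ⟨l, hl.comp (tendsto_nhdsWithin_iff.2 ⟨hL, Eventually.of_forall fun n => ?_⟩)⟩
    exact lt_of_le_of_ne (hle n) (h n)

lemma IsCadlag.tendsto_of_ge (hx : IsCadlag x) {ι : Type*} {l : Filter ι} {T : ι → ℝ≥0}
    {L : ℝ≥0} (hle : ∀ i, L ≤ T i) (hL : Tendsto T l (𝓝 L)) :
    Tendsto (fun i => x (T i)) l (𝓝 (x L)) :=
  Tendsto.comp (hx.continuousWithinAt L)
    (tendsto_nhdsWithin_iff.2 ⟨hL, Eventually.of_forall hle⟩)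

/-- Times before `c` at which a right-continuous path is in an open set can be found in a dense
sequence. -/
lemma IsCadlag.exists_denseSeq (hx : IsCadlag x) {φ : S → ℝ} (hφ : Continuous φ) (c : ℝ≥0)
    (δ : ℝ) :
    (∃ i, TopologicalSpace.denseSeq ℝ≥0 i < c ∧
      φ (x (TopologicalSpace.denseSeq ℝ≥0 i)) < δ) ↔ ∃ s < c, φ (x s) < δ := by
  constructor
  · rintro ⟨i, hi, h⟩
    exact ⟨_, hi, h⟩
  · rintro ⟨s, hs, h⟩
    have h1 : ∀ᶠ u in 𝓝[≥] s, φ (x u) < δ :=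
      ((hφ.tendsto _).comp (hx.continuousWithinAt s)).eventually (gt_mem_nhds h)
    -- The strict inequality `s < c` leaves room to the right of `s` for a point of the dense
    -- sequence.
    obtain ⟨b, hb, hsub⟩ := (mem_nhdsGE_iff_exists_Ico_subset' hs).1 h1
    obtain ⟨y, ⟨i, rfl⟩, hy⟩ := (TopologicalSpace.denseRange_denseSeq ℝ≥0).exists_between
      (lt_min hs hb : s < min c b)
    exact ⟨i, hy.2.trans_le (min_le_left _ _), hsub ⟨hy.1.le, hy.2.trans_le (min_le_right _ _)⟩⟩

end Paths

section Shift

variable {S : Type*} [TopologicalSpace S] {x : ℝ≥0 → S}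

lemma IsCadlag.shift (hx : IsCadlag x) (s : ℝ≥0) : IsCadlag fun u => x (s + u) := by
  intro t
  refine ⟨?_, ?_⟩
  · refine Tendsto.comp (hx.continuousWithinAt (s + t)) (tendsto_nhdsWithin_iff.2 ⟨?_, ?_⟩)
    · exact ((continuous_const_add s).tendsto t).mono_left nhdsWithin_le_nhds
    · filter_upwards [self_mem_nhdsWithin] with u hu
      exact add_le_add_right (mem_Ici.1 hu) s
  · obtain ⟨l, hl⟩ := (hx (s + t)).2
    refine ⟨l, hl.comp (tendsto_nhdsWithin_iff.2 ⟨?_, ?_⟩)⟩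
    · exact ((continuous_const_add s).tendsto t).mono_left nhdsWithin_le_nhds
    · filter_upwards [self_mem_nhdsWithin] with u hu
      exact add_lt_add_right (mem_Iio.1 hu) s

end Shift

/-! ### Product measurable versions of the weight and of survival -/

section Functionals

/-- The smallest multiple of `1 / (n + 1)` that is at least `s`, cut off at `t`. -/
noncomputable def gridTime (n : ℕ) (t s : ℝ≥0) : ℝ≥0 := min ((⌈s * (n + 1)⌉₊ : ℝ≥0) / (n + 1)) t

/-- The cut-off at `t` makes the sampled integral depend on the path up to `t` only, hence
measurable for the past of `t`. -/
lemma gridTime_le (n : ℕ) (t s : ℝ≥0) : gridTime n t s ≤ t := min_le_right _ _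

/-- Sampling never precedes `s`, so right-continuity alone makes the sampled values converge. -/
lemma le_gridTime (n : ℕ) {t s : ℝ≥0} (hs : s ≤ t) : s ≤ gridTime n t s := by
  refine le_min ?_ hs
  rw [le_div_iff₀ (by positivity)]
  exact Nat.le_ceil _

lemma gridTime_le_add (n : ℕ) (t s : ℝ≥0) : gridTime n t s ≤ s + 1 / (n + 1) := by
  refine (min_le_left _ _).trans ?_
  rw [div_le_iff₀ (by positivity), add_mul, one_div, inv_mul_cancel₀ (by positivity)]
  exact (Nat.ceil_lt_add_one zero_le).le

lemma tendsto_gridTime {t s : ℝ≥0} (hs : s ≤ t) :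
    Tendsto (fun n => gridTime n t s) atTop (𝓝 s) := by
  refine tendsto_of_tendsto_of_tendsto_of_le_of_le tendsto_const_nhds ?_
    (fun n => le_gridTime n hs) (fun n => gridTime_le_add n t s)
  have : Tendsto (fun n : ℕ => s + 1 / ((n : ℝ≥0) + 1)) atTop (𝓝 (s + 0)) :=
    tendsto_const_nhds.add tendsto_one_div_add_atTop_nhds_zero_nat
  simpa using this

variable {S : Type*}

/-- The integral of the potential along the path sampled on a grid. -/
noncomputable def gridPotential (V : S → ℝ) (t : ℝ≥0) (n : ℕ) (x : ℝ≥0 → S) : ℝ :=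
  ∫ s in (0 : ℝ)..t, V (x (gridTime n t s.toNNReal))

/-- A product measurable version of the Feynman-Kac weight of a path, for a potential that is
bounded from below by `-c`. -/
noncomputable def weight (V : S → ℝ) (c : ℝ) (t : ℝ≥0) (x : ℝ≥0 → S) : ℝ :=
  min (Real.exp (-limsup (fun n => gridPotential V t n x) atTop)) (Real.exp (c * t))

lemma weight_nonneg (V : S → ℝ) (c : ℝ) (t : ℝ≥0) (x : ℝ≥0 → S) : 0 ≤ weight V c t x :=
  le_min (Real.exp_pos _).le (Real.exp_pos _).le

/-- The minimum in `weight` makes this hold on every path, including those where the `limsup` is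
meaningless, so that the functional is bounded on the whole path space. -/
lemma weight_le (V : S → ℝ) (c : ℝ) (t : ℝ≥0) (x : ℝ≥0 → S) :
    weight V c t x ≤ Real.exp (c * t) := min_le_right _ _

lemma abs_weight_le (V : S → ℝ) (c : ℝ) (t : ℝ≥0) (x : ℝ≥0 → S) :
    |weight V c t x| ≤ Real.exp (c * t) := by
  rw [abs_of_nonneg (weight_nonneg V c t x)]
  exact weight_le V c t x

/-- The paths that are in `{φ < δ}` at some time of a dense sequence before `c`. -/
def entersBefore (φ : S → ℝ) (δ : ℝ) (c : ℝ≥0) : Set (ℝ≥0 → S) :=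
  {x | ∃ i, TopologicalSpace.denseSeq ℝ≥0 i < c ∧ φ (x (TopologicalSpace.denseSeq ℝ≥0 i)) < δ}

/-- The entrance time of a path into `{φ < δ}`. -/
noncomputable def entry (φ : S → ℝ) (δ : ℝ) (x : ℝ≥0 → S) : ℝ≥0 := sInf {s | φ (x s) < δ}

/-- The paths that stay away from the zero set of `φ` up to time `t`. -/
def survival (φ : S → ℝ) (t : ℝ≥0) : Set (ℝ≥0 → S) :=
  {x | 0 < φ (x t) ∧ ∃ n : ℕ, x ∉ entersBefore φ (1 / ((n : ℝ) + 1)) t}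

/-- Measurability is asked only up to time `c`, so that this serves both the coordinates of path
space and the `σ`-algebras of the filtration. -/
lemma measurableSet_entersBefore {Ω : Type*} [MeasurableSpace Ω] [MeasurableSpace S] {φ : S → ℝ}
    (hφ : Measurable φ) (δ : ℝ) (c : ℝ≥0) {Y : ℝ≥0 → Ω → S} (hY : ∀ u ≤ c, Measurable (Y u)) :
    MeasurableSet {ω | (fun u => Y u ω) ∈ entersBefore φ δ c} := by
  simp only [entersBefore, ofPred_exists]
  simp only [mem_iUnion, mem_ofPred_eq, ofPred_exists]
  refine MeasurableSet.iUnion fun i : ℕ => ?_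
  by_cases hi : TopologicalSpace.denseSeq ℝ≥0 i < c
  · simp only [hi, true_and]
    exact measurableSet_lt (hφ.comp (hY _ hi.le)) measurable_const
  · simp [hi]

lemma measurable_ceil_mul (n : ℕ) :
    Measurable fun s : ℝ => ⌈s.toNNReal * ((n : ℝ≥0) + 1)⌉₊ :=
  Nat.measurable_ceil.comp (by fun_prop)

/-- The sampled path depends on the time through a countable index, so joint measurability needs no
regularity of the paths. -/
lemma measurable_gridPotential {Ω : Type*} [MeasurableSpace Ω] [MeasurableSpace S] {V : S → ℝ}
    (hV : Measurable V) (t : ℝ≥0) {Y : ℝ≥0 → Ω → S} (hY : ∀ u ≤ t, Measurable (Y u)) (n : ℕ) :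
    Measurable fun ω => gridPotential V t n fun u => Y u ω := by
  have h1 : Measurable fun p : Ω × ℕ => Y (min ((p.2 : ℝ≥0) / (n + 1)) t) p.1 :=
    measurable_from_prod_countable_left fun j =>
      hY (min ((j : ℝ≥0) / (n + 1)) t) (min_le_right _ _)
  have h0 : Measurable fun p : Ω × ℝ => (p.1, ⌈p.2.toNNReal * ((n : ℝ≥0) + 1)⌉₊) :=
    measurable_fst.prodMk ((measurable_ceil_mul n).comp measurable_snd)
  have h2 : Measurable fun p : Ω × ℝ => V (Y (gridTime n t p.2.toNNReal) p.1) := by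
    have h := hV.comp (h1.comp h0)
    simp only [Function.comp_def] at h
    simpa only [gridTime] using h
  have h3 := (h2.stronglyMeasurable.integral_prod_right'
    (ν := volume.restrict (Ioc (0 : ℝ) t))).measurable
  unfold gridPotential
  simpa only [intervalIntegral.integral_of_le t.coe_nonneg] using h3

lemma measurable_weight {Ω : Type*} [MeasurableSpace Ω] [MeasurableSpace S] {V : S → ℝ}
    (hV : Measurable V) (c : ℝ) (t : ℝ≥0) {Y : ℝ≥0 → Ω → S} (hY : ∀ u ≤ t, Measurable (Y u)) :
    Measurable fun ω => weight V c t fun u => Y u ω := by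
  have := Measurable.limsup (fun n => measurable_gridPotential hV t hY n)
  exact (Real.measurable_exp.comp this.neg).min measurable_const

lemma measurableSet_survival [MeasurableSpace S] {φ : S → ℝ} (hφ : Measurable φ) (t : ℝ≥0) :
    MeasurableSet (survival φ t) := by
  simp only [survival, ofPred_and, ofPred_exists]
  refine (measurableSet_lt measurable_const (hφ.comp (measurable_pi_apply t))).inter
    (MeasurableSet.iUnion fun n => ?_)
  exact (measurableSet_entersBefore hφ _ t (Y := fun u (x : ℝ≥0 → S) => x u)
    fun u _ => measurable_pi_apply u).compl

variable {x : ℝ≥0 → S}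

lemma neg_mul_le_integral {V : S → ℝ} {c : ℝ} (hc : ∀ y, -c ≤ V y) {t : ℝ≥0}
    (hint : IntervalIntegrable (fun s : ℝ => V (x s.toNNReal)) volume 0 t) :
    -(c * t) ≤ ∫ s in (0 : ℝ)..t, V (x s.toNNReal) := by
  have := intervalIntegral.integral_mono_on t.coe_nonneg
    (intervalIntegrable_const (c := -c)) hint (fun s _ => hc (x s.toNNReal))
  simp only [intervalIntegral.integral_const, sub_zero, smul_eq_mul] at this
  linarith

variable [TopologicalSpace S]

lemma IsCadlag.tendsto_gridPotential (hx : IsCadlag x) {V : S → ℝ} (hV : Continuous V)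
    (t : ℝ≥0) :
    Tendsto (fun n => gridPotential V t n x) atTop
      (𝓝 (∫ s in (0 : ℝ)..t, V (x s.toNNReal))) := by
  obtain ⟨C, hC⟩ := hx.exists_bound hV t
  refine intervalIntegral.tendsto_integral_filter_of_dominated_convergence (fun _ => C) ?_ ?_
    intervalIntegrable_const ?_
  · refine Eventually.of_forall fun n => ?_
    have h : Measurable fun j : ℕ => V (x (min ((j : ℝ≥0) / (n + 1)) t)) :=
      measurable_of_countable _
    exact (h.comp (measurable_ceil_mul n)).aestronglyMeasurable
  · exact Eventually.of_forall fun n => Eventually.of_forall fun s _ =>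
      hC _ (gridTime_le n t _)
  · refine Eventually.of_forall fun s hs => ?_
    rw [uIoc_of_le t.coe_nonneg] at hs
    have hst : s.toNNReal ≤ t := Real.toNNReal_le_iff_le_coe.2 hs.2
    exact (hV.tendsto _).comp
      (hx.tendsto_of_ge (fun n => le_gridTime n hst) (tendsto_gridTime hst))

/-- On a càdlàg path the `limsup` is a limit, and `V ≥ -c` makes the minimum inactive. -/
lemma IsCadlag.weight_eq (hx : IsCadlag x) {V : S → ℝ} (hV : Continuous V) {c : ℝ}
    (hc : ∀ y, -c ≤ V y) {t : ℝ≥0}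
    (hint : IntervalIntegrable (fun s : ℝ => V (x s.toNNReal)) volume 0 t) :
    weight V c t x = Real.exp (-∫ s in (0 : ℝ)..t, V (x s.toNNReal)) := by
  rw [weight, (hx.tendsto_gridPotential hV t).limsup_eq]
  refine min_eq_left (Real.exp_le_exp.2 ?_)
  linarith [neg_mul_le_integral hc hint]

/-- The weights are multiplicative along the path. -/
lemma IsCadlag.weight_add (hx : IsCadlag x) {V : S → ℝ} (hV : Continuous V) {c : ℝ}
    (hc : ∀ y, -c ≤ V y) {s u : ℝ≥0}
    (hint : IntervalIntegrable (fun r : ℝ => V (x r.toNNReal)) volume 0 (s + u : ℝ≥0)) :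
    weight V c s x * weight V c u (fun r => x (s + r)) = weight V c (s + u) x := by
  have hs : IntervalIntegrable (fun r : ℝ => V (x r.toNNReal)) volume 0 s :=
    hint.mono_set (uIcc_subset_uIcc_left (by simp [uIcc_of_le, add_nonneg]))
  have hsu : IntervalIntegrable (fun r : ℝ => V (x r.toNNReal)) volume s (s + u : ℝ≥0) :=
    hint.mono_set (uIcc_subset_uIcc_right (by simp [uIcc_of_le, add_nonneg]))
  have hshift : ∀ r ∈ uIcc (0 : ℝ) u,
      V (x (s + r.toNNReal)) = V (x ((r + s : ℝ).toNNReal)) := by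
    intro r hr
    rw [uIcc_of_le u.coe_nonneg] at hr
    rw [Real.toNNReal_add hr.1 s.coe_nonneg, Real.toNNReal_coe, add_comm]
  have hsu' : IntervalIntegrable (fun r : ℝ => V (x (s + r.toNNReal))) volume 0 u := by
    have h := hsu.comp_add_right (s : ℝ)
    simp only [NNReal.coe_add, sub_self, add_sub_cancel_left] at h
    refine h.congr ?_
    intro r hr
    exact (hshift r (uIoc_subset_uIcc hr)).symm
  have hval : ∫ r in (0 : ℝ)..u, V (x (s + r.toNNReal))
      = ∫ r in (s : ℝ)..(s + u : ℝ≥0), V (x r.toNNReal) := by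
    rw [intervalIntegral.integral_congr hshift,
      intervalIntegral.integral_comp_add_right (fun r => V (x r.toNNReal))]
    simp [add_comm]
  rw [hx.weight_eq hV hc hs, (hx.shift s).weight_eq hV hc hsu', hx.weight_eq hV hc hint,
    ← Real.exp_add, hval, ← intervalIntegral.integral_add_adjacent_intervals hs hsu]
  congr 1
  ring

lemma IsCadlag.mem_entersBefore_iff (hx : IsCadlag x) {φ : S → ℝ} (hφ : Continuous φ) (δ : ℝ)
    (c : ℝ≥0) : x ∈ entersBefore φ δ c ↔ ∃ s < c, φ (x s) < δ :=
  hx.exists_denseSeq hφ c δ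

/-- Nonemptiness has to be recorded: a path that never enters has `entry` equal to `sInf ∅ = 0`. -/
lemma IsCadlag.mem_entersBefore_iff_entry (hx : IsCadlag x) {φ : S → ℝ} (hφ : Continuous φ)
    (δ : ℝ) (c : ℝ≥0) :
    x ∈ entersBefore φ δ c ↔ {s | φ (x s) < δ}.Nonempty ∧ entry φ δ x < c := by
  rw [hx.mem_entersBefore_iff hφ]
  constructor
  · rintro ⟨s, hs, h⟩
    exact ⟨⟨s, h⟩, (csInf_le (OrderBot.bddBelow _) (show s ∈ {s | φ (x s) < δ} from h)).trans_lt hs⟩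
  · rintro ⟨hne, h⟩
    obtain ⟨s, hs, hsc⟩ := exists_lt_of_csInf_lt hne h
    exact ⟨s, hsc, hs⟩

/-- The infimum is a limit from the right of times in the set, so only the weak inequality survives.
-/
lemma IsCadlag.apply_entry_le (hx : IsCadlag x) {φ : S → ℝ} (hφ : Continuous φ) {δ : ℝ}
    (hne : {s | φ (x s) < δ}.Nonempty) : φ (x (entry φ δ x)) ≤ δ := by
  by_contra! h
  have h1 : ∀ᶠ u in 𝓝[≥] (entry φ δ x), δ < φ (x u) :=
    ((hφ.tendsto _).comp (hx.continuousWithinAt _)).eventually (lt_mem_nhds h)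
  obtain ⟨b, hb, hsub⟩ := mem_nhdsGE_iff_exists_Ico_subset.1 h1
  obtain ⟨s, hs, hsb⟩ := exists_lt_of_csInf_lt hne hb
  have hlt : δ < φ (x s) := hsub ⟨csInf_le (OrderBot.bddBelow _) hs, hsb⟩
  exact lt_asymm hlt hs

lemma IsCadlag.mem_survival_iff (hx : IsCadlag x) {φ : S → ℝ} (hφ : Continuous φ) (t : ℝ≥0) :
    x ∈ survival φ t ↔ 0 < φ (x t) ∧ ∃ n : ℕ, ∀ s < t, 1 / ((n : ℝ) + 1) ≤ φ (x s) := by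
  simp only [survival, mem_ofPred_eq, hx.mem_entersBefore_iff hφ]
  push Not
  rfl

/-- The value at time `s` is tested by the shifted path, so the first factor only looks at times
before `s`. Of two thresholds the smaller one works for both pieces. -/
lemma IsCadlag.mem_survival_add_iff (hx : IsCadlag x) {φ : S → ℝ} (hφ : Continuous φ)
    (s u : ℝ≥0) :
    x ∈ survival φ (s + u) ↔
      (∃ n : ℕ, ∀ r < s, 1 / ((n : ℝ) + 1) ≤ φ (x r)) ∧
        (fun r => x (s + r)) ∈ survival φ u := by
  rw [hx.mem_survival_iff hφ, (hx.shift s).mem_survival_iff hφ]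
  constructor
  · rintro ⟨h0, n, hn⟩
    exact ⟨⟨n, fun r hr => hn r (hr.trans_le le_self_add)⟩, h0, n,
      fun r hr => hn _ (add_lt_add_right hr s)⟩
  · rintro ⟨⟨n, hn⟩, h0, m, hm⟩
    refine ⟨h0, max n m, fun r hr => ?_⟩
    rcases lt_or_ge r s with h | h
    · refine le_trans (one_div_le_one_div_of_le (by positivity) ?_) (hn r h)
      gcongr
      exact le_max_left _ _
    · obtain ⟨v, rfl⟩ := exists_add_of_le h
      refine le_trans (one_div_le_one_div_of_le (by positivity) ?_)
        (hm v (lt_of_add_lt_add_left hr))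
      gcongr
      exact le_max_right _ _

end Functionals

/-! ### The Markov property in integral form -/

section Markov

/-- Rectangle form to integral form of a disintegration of the joint law of `(a, b)`. -/
lemma integral_mul_eq_of_disintegration {Ω α β : Type*} [MeasurableSpace Ω] {P : Measure Ω}
    [IsFiniteMeasure P] [mα : MeasurableSpace α] [MeasurableSpace β] {a : Ω → α} {b : Ω → β}
    (ha : Measurable a) (hb : Measurable b) (κ : Kernel α β) [IsMarkovKernel κ]
    (h : ∀ G A, MeasurableSet G → MeasurableSet A →
      P (a ⁻¹' G ∩ b ⁻¹' A) = ∫⁻ ω in a ⁻¹' G, κ (a ω) A ∂P)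
    {W : α → ℝ} (hW : Measurable W) {C : ℝ} (hWC : ∀ y, |W y| ≤ C)
    {F : β → ℝ} (hF : IsBoundedMeasurable F) :
    ∫ ω, W (a ω) * F (b ω) ∂P = ∫ ω, W (a ω) * ∫ y, F y ∂κ (a ω) ∂P := by
  obtain ⟨hFm, C', hC'⟩ := hF
  have hmeas : Measurable fun p : α × β => W p.1 * F p.2 :=
    (hW.comp measurable_fst).mul (hFm.comp measurable_snd)
  -- Rectangles determine a finite measure on the product.
  have hlaw : P.map (fun ω => (a ω, b ω)) = (P.map a) ⊗ₘ κ := by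
    refine Measure.ext_prod fun {G A} hG hA => ?_
    rw [Measure.map_apply (ha.prodMk hb) (hG.prod hA), Measure.compProd_apply_prod hG hA,
      setLIntegral_map hG (κ.measurable_coe hA) ha, ← h G A hG hA]
    rfl
  have hint : Integrable (fun p : α × β => W p.1 * F p.2) ((P.map a) ⊗ₘ κ) := by
    refine Integrable.of_bound hmeas.aestronglyMeasurable (C * C') (ae_of_all _ fun p => ?_)
    rw [norm_mul]
    exact mul_le_mul (hWC _) (hC' _) (norm_nonneg _) ((abs_nonneg _).trans (hWC p.1))
  have h1 := integral_map (μ := P) (ha.prodMk hb).aemeasurable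
    (f := fun p : α × β => W p.1 * F p.2) hmeas.aestronglyMeasurable
  simp only at h1
  rw [← h1, hlaw, Measure.integral_compProd hint, integral_map ha.aemeasurable]
  · simp only [integral_const_mul]
  · simp only [integral_const_mul]
    exact (hW.stronglyMeasurable.mul hFm.stronglyMeasurable.integral_kernel).aestronglyMeasurable

variable {Ω S : Type*} [mΩ : MeasurableSpace Ω] [MeasurableSpace S] [TopologicalSpace S]
  {P : Measure Ω} {𝓕 : S → Filtration ℝ≥0 mΩ} {X : S → ℝ≥0 → Ω → S}

lemma IsCadlagStrongMarkov.measurable (hX : IsCadlagStrongMarkov P 𝓕 X) (z : S) (t : ℝ≥0) :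
    Measurable (X z t) :=
  (hX.adapted z t).mono ((𝓕 z).le t) le_rfl

lemma IsCadlagStrongMarkov.measurable_path (hX : IsCadlagStrongMarkov P 𝓕 X) (z : S) :
    Measurable fun ω t => X z t ω :=
  measurable_pi_lambda _ fun t => hX.measurable z t

lemma IsCadlagStrongMarkov.integral_pathLaw (hX : IsCadlagStrongMarkov P 𝓕 X) (z : S)
    {F : (ℝ≥0 → S) → ℝ} (hF : Measurable F) :
    ∫ x, F x ∂pathLaw P (X z) = ∫ ω, F (fun t => X z t ω) ∂P :=
  integral_map (hX.measurable_path z).aemeasurable hF.aestronglyMeasurable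

lemma IsCadlagStrongMarkov.measurable_integral (hX : IsCadlagStrongMarkov P 𝓕 X)
    {F : (ℝ≥0 → S) → ℝ} (hF : Measurable F) :
    Measurable fun z => ∫ ω, F (fun t => X z t ω) ∂P := by
  have h := (hF.stronglyMeasurable.integral_kernel
    (κ := (⟨fun z => pathLaw P (X z), hX.measurable_law⟩ : Kernel S (ℝ≥0 → S)))).measurable
  simpa only [Kernel.coe_mk, hX.integral_pathLaw _ hF] using h

/-- The Markov property at deterministic times, with a bounded weight from the past. -/
lemma IsCadlagStrongMarkov.markov [IsProbabilityMeasure P]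
    (hX : IsCadlagStrongMarkov P 𝓕 X) (z : S) (s : ℝ≥0)
    {W : Ω → ℝ} (hW : Measurable[𝓕 z s] W) {C : ℝ} (hWC : ∀ ω, |W ω| ≤ C)
    {F : (ℝ≥0 → S) → ℝ} (hF : IsBoundedMeasurable F) :
    ∫ ω, W ω * F (fun u => X z (s + u) ω) ∂P
      = ∫ ω, W ω * ∫ ω', F (fun u => X (X z s ω) u ω') ∂P ∂P := by
  have hprob : ∀ y, IsProbabilityMeasure (pathLaw P (X y)) := fun y =>
    Measure.isProbabilityMeasure_map (hX.measurable_path y).aemeasurable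
  -- The whole past is kept by using the identity map into `Ω` with the `σ`-algebra `𝓕 z s`, from
  -- which the kernel starts.
  let κ : @Kernel Ω (ℝ≥0 → S) (𝓕 z s) _ :=
    @Kernel.mk Ω (ℝ≥0 → S) (𝓕 z s) _ (fun ω => pathLaw P (X (X z s ω)))
      (hX.measurable_law.comp (hX.adapted z s))
  have hκ : @IsMarkovKernel Ω (ℝ≥0 → S) (𝓕 z s) _ κ :=
    @IsMarkovKernel.mk Ω (ℝ≥0 → S) (𝓕 z s) _ κ fun ω => hprob _
  have key := @integral_mul_eq_of_disintegration Ω Ω (ℝ≥0 → S) mΩ P _ (𝓕 z s) _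
    id (fun ω u => X z (s + u) ω) (measurable_id'' ((𝓕 z).le s))
    (measurable_pi_lambda _ fun u => hX.measurable z (s + u)) κ hκ
    (fun G A hG hA => by
      have h := hX.strong_markov z (fun _ => (s : WithTop ℝ≥0)) (isStoppingTime_const _ s) G
        (by rwa [IsStoppingTime.measurableSpace_const]) A hA
      simp only [ne_eq, WithTop.coe_ne_top, not_false_eq_true, true_and, and_true,
        WithTop.untopD_coe, ofPred_mem_eq] at h
      exact h)
    W hW C hWC F hF
  refine key.trans ?_
  refine integral_congr_ae (ae_of_all _ fun ω => ?_)
  exact congrArg (W ω * ·) (hX.integral_pathLaw _ hF.1)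

end Markov

/-! ### Discretised entrance times -/

section Entrance

/-- The entrance time into `{φ < δ}`, approximated strictly from above by multiples of
`1 / (k + 1)`. -/
noncomputable def gridEntry {S : Type*} (φ : S → ℝ) (δ : ℝ) (k : ℕ) (x : ℝ≥0 → S) : ℝ≥0 :=
  ((⌊entry φ δ x * (k + 1)⌋₊ : ℝ≥0) + 1) / (k + 1)

lemma entry_le_gridEntry {S : Type*} (φ : S → ℝ) (δ : ℝ) (k : ℕ) (x : ℝ≥0 → S) :
    entry φ δ x ≤ gridEntry φ δ k x := by
  rw [gridEntry, le_div_iff₀ (by positivity)]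
  exact (Nat.lt_floor_add_one _).le

lemma tendsto_gridEntry {S : Type*} (φ : S → ℝ) (δ : ℝ) (x : ℝ≥0 → S) :
    Tendsto (fun k => gridEntry φ δ k x) atTop (𝓝 (entry φ δ x)) := by
  refine tendsto_of_tendsto_of_tendsto_of_le_of_le (h := fun k : ℕ => entry φ δ x + 1 / (k + 1))
    tendsto_const_nhds ?_ (fun k => entry_le_gridEntry φ δ k x) fun k => ?_
  · simpa using (tendsto_const_nhds (x := entry φ δ x)).add
      (tendsto_one_div_add_atTop_nhds_zero_nat (𝕜 := ℝ≥0))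
  · rw [gridEntry, add_div]
    refine add_le_add_left ?_ _
    rw [div_le_iff₀ (by positivity)]
    exact Nat.floor_le zero_le

/-- The paths that enter `{φ < δ}` before `r`, and do so in a given cell of the grid. -/
def entersIn {S : Type*} (φ : S → ℝ) (δ : ℝ) (r : ℝ≥0) (k j : ℕ) : Set (ℝ≥0 → S) :=
  entersBefore φ δ (min r (((j : ℝ≥0) + 1) / (k + 1))) \ entersBefore φ δ ((j : ℝ≥0) / (k + 1))

/-- Exactly one cell contains an entering path, the one with index `⌊entry φ δ x * (k + 1)⌋₊`. On it
the grid time is a constant, so the Markov property at deterministic times applies to each summand.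
-/
lemma IsCadlag.sum_entersIn {S : Type*} [TopologicalSpace S] {x : ℝ≥0 → S} (hx : IsCadlag x)
    {φ : S → ℝ} (hφ : Continuous φ) (δ : ℝ) (r : ℝ≥0) (k : ℕ) (ψ : ℝ≥0 → ℝ) :
    ∑ j ∈ Finset.range (⌊r * (k + 1)⌋₊ + 1),
        (entersIn φ δ r k j).indicator 1 x * ψ (((j : ℝ≥0) + 1) / (k + 1))
      = (entersBefore φ δ r).indicator 1 x * ψ (gridEntry φ δ k x) := by
  have hk : (0 : ℝ≥0) < k + 1 := by positivity
  have hmem : ∀ j, x ∈ entersIn φ δ r k j ↔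
      x ∈ entersBefore φ δ r ∧ ⌊entry φ δ x * (k + 1)⌋₊ = j := by
    intro j
    simp only [entersIn, Set.mem_sdiff, hx.mem_entersBefore_iff_entry hφ, lt_min_iff,
      Nat.floor_eq_iff (zero_le : 0 ≤ entry φ δ x * (k + 1)), lt_div_iff₀ hk]
    constructor
    · rintro ⟨⟨hne, h1, h2⟩, h3⟩
      exact ⟨⟨hne, h1⟩, not_lt.1 fun h => h3 ⟨hne, h⟩, h2⟩
    · rintro ⟨⟨hne, h1⟩, h2, h3⟩
      exact ⟨⟨hne, h1, h3⟩, fun h => h2.not_gt h.2⟩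
  by_cases hE : x ∈ entersBefore φ δ r
  · rw [Finset.sum_eq_single ⌊entry φ δ x * (k + 1)⌋₊]
    · rw [indicator_of_mem ((hmem _).2 ⟨hE, rfl⟩), indicator_of_mem hE, gridEntry]
    · intro j _ hj
      rw [indicator_of_notMem fun h => hj ((hmem j).1 h).2.symm, zero_mul]
    · intro h
      refine absurd (Finset.mem_range.2 (Nat.lt_succ_of_le (Nat.floor_mono ?_))) h
      have := ((hx.mem_entersBefore_iff_entry hφ δ r).1 hE).2.le
      gcongr
  · rw [indicator_of_notMem hE, zero_mul]
    refine Finset.sum_eq_zero fun j _ => ?_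
    rw [indicator_of_notMem fun h => hE ((hmem j).1 h).1, zero_mul]

end Entrance

/-! ### Strong Markov property at entrance times -/

section StrongMarkov

lemma abs_transition_le {Ω S : Type*} [MeasurableSpace Ω] {P : Measure Ω}
    [IsProbabilityMeasure P] (X : S → ℝ≥0 → Ω → S) (u : ℝ≥0)
    {g : S → ℝ} {C : ℝ} (hC : ∀ y, |g y| ≤ C) (y : S) : |transition P X u g y| ≤ C := by
  have := norm_integral_le_of_norm_le_const (μ := P) (f := fun ω => g (X y u ω))
    (ae_of_all _ fun ω => hC (X y u ω))
  simpa [transition] using this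

variable {Ω S : Type*} [mΩ : MeasurableSpace Ω] [MeasurableSpace S] [TopologicalSpace S]
  {P : Measure Ω} {𝓕 : S → Filtration ℝ≥0 mΩ}
  {X : S → ℝ≥0 → Ω → S}

/-- A cell is decided strictly before its right endpoint. Rounding the entrance time up thus avoids
any right-continuity of the filtration. -/
lemma IsCadlagStrongMarkov.measurable_entersIn [BorelSpace S]
    (hX : IsCadlagStrongMarkov P 𝓕 X) {φ : S → ℝ}
    (hφ : Continuous φ) (δ : ℝ) (z : S) (r : ℝ≥0) (k j : ℕ) :
    Measurable[𝓕 z (((j : ℝ≥0) + 1) / (k + 1))]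
      fun ω => (entersIn φ δ r k j).indicator (1 : (ℝ≥0 → S) → ℝ) (fun t => X z t ω) := by
  have h : ∀ c ≤ ((j : ℝ≥0) + 1) / (k + 1),
      MeasurableSet[𝓕 z (((j : ℝ≥0) + 1) / (k + 1))]
        {ω | (fun t => X z t ω) ∈ entersBefore φ δ c} := fun c hc =>
    @measurableSet_entersBefore S Ω (𝓕 z (((j : ℝ≥0) + 1) / (k + 1))) _ φ hφ.measurable δ c
      (X z) fun u hu => (hX.adapted z u).mono ((𝓕 z).mono (hu.trans hc)) le_rfl
  have hset := (h _ (min_le_right r _)).diff (h ((j : ℝ≥0) / (k + 1)) (by gcongr; simp))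
  exact Measurable.indicator (@measurable_const ℝ Ω _ (𝓕 z (((j : ℝ≥0) + 1) / (k + 1))) 1) hset

lemma IsCadlagStrongMarkov.ae_sum_entersIn (hX : IsCadlagStrongMarkov P 𝓕 X) {φ : S → ℝ}
    (hφ : Continuous φ) (δ : ℝ) (z : S) (r u : ℝ≥0) (k : ℕ) (ψ : S → ℝ) :
    (fun ω => ∑ j ∈ Finset.range (⌊r * (k + 1)⌋₊ + 1),
        (entersIn φ δ r k j).indicator 1 (fun t => X z t ω)
          * ψ (X z (((j : ℝ≥0) + 1) / (k + 1) + u) ω))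
      =ᵐ[P] fun ω => (entersBefore φ δ r).indicator 1 (fun t => X z t ω)
          * ψ (X z (gridEntry φ δ k (fun t => X z t ω) + u) ω) := by
  filter_upwards [hX.cadlag z] with ω hω
  exact hω.sum_entersIn hφ δ r k fun s => ψ (X z (s + u) ω)

lemma IsCadlagStrongMarkov.integrable_entersIn [BorelSpace S] [IsProbabilityMeasure P]
    (hX : IsCadlagStrongMarkov P 𝓕 X) {φ : S → ℝ}
    (hφ : Continuous φ) (δ : ℝ) (z : S) (r u : ℝ≥0) (k j : ℕ) {ψ : S → ℝ}
    (hψ : IsBoundedMeasurable ψ) :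
    Integrable (fun ω => (entersIn φ δ r k j).indicator 1 (fun t => X z t ω)
      * ψ (X z (((j : ℝ≥0) + 1) / (k + 1) + u) ω)) P := by
  obtain ⟨hψm, C, hC⟩ := hψ
  refine Integrable.of_bound (C := 1 * C) ?_ (ae_of_all _ fun ω => ?_)
  · exact (((hX.measurable_entersIn hφ δ z r k j).mono ((𝓕 z).le _) le_rfl).mul
      (hψm.comp (hX.measurable z _))).aestronglyMeasurable
  · rw [norm_mul]
    refine mul_le_mul ?_ (hC _) (norm_nonneg _) zero_le_one
    by_cases h : (fun t => X z t ω) ∈ entersIn φ δ r k j <;> simp [h]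

lemma IsCadlagStrongMarkov.isBoundedMeasurable_transition [IsProbabilityMeasure P]
    (hX : IsCadlagStrongMarkov P 𝓕 X)
    (u : ℝ≥0) {g : S → ℝ} (hg : IsBoundedMeasurable g) :
    IsBoundedMeasurable (transition P X u g) := by
  obtain ⟨hgm, C, hC⟩ := hg
  exact ⟨hX.measurable_integral (F := fun x => g (x u)) (hgm.comp (measurable_pi_apply u)), C,
    abs_transition_le X u hC⟩

/-- The Markov property at the discretised entrance time. -/
lemma IsCadlagStrongMarkov.markov_gridEntry [BorelSpace S] [IsProbabilityMeasure P]
    (hX : IsCadlagStrongMarkov P 𝓕 X) {φ : S → ℝ}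
    (hφ : Continuous φ) (δ : ℝ) (z : S) (r u : ℝ≥0) (k : ℕ) {g : S → ℝ}
    (hg : IsBoundedMeasurable g) :
    ∫ ω, (entersBefore φ δ r).indicator 1 (fun t => X z t ω)
        * g (X z (gridEntry φ δ k (fun t => X z t ω) + u) ω) ∂P
      = ∫ ω, (entersBefore φ δ r).indicator 1 (fun t => X z t ω)
        * transition P X u g (X z (gridEntry φ δ k (fun t => X z t ω)) ω) ∂P := by
  have hU := hX.isBoundedMeasurable_transition u hg
  rw [← integral_congr_ae (hX.ae_sum_entersIn hφ δ z r u k g),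
    integral_finsetSum _ fun j _ => hX.integrable_entersIn hφ δ z r u k j hg]
  have h0 := integral_congr_ae (hX.ae_sum_entersIn hφ δ z r 0 k (transition P X u g))
  rw [integral_finsetSum _ fun j _ => hX.integrable_entersIn hφ δ z r 0 k j hU] at h0
  simp only [add_zero] at h0
  rw [← h0]
  refine Finset.sum_congr rfl fun j _ => ?_
  obtain ⟨hgm, C, hC⟩ := hg
  refine hX.markov z _ (hX.measurable_entersIn hφ δ z r k j) (C := 1) (fun ω => ?_)
    (F := fun x => g (x u)) ⟨hgm.comp (measurable_pi_apply u), C, fun x => hC _⟩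
  by_cases h : (fun t => X z t ω) ∈ entersIn φ δ r k j <;> simp [h]

lemma IsCadlagStrongMarkov.tendsto_gridEntry (hX : IsCadlagStrongMarkov P 𝓕 X) {φ : S → ℝ}
    (δ : ℝ) (z : S) (r u : ℝ≥0) {ψ : S → ℝ} (hψ : Continuous ψ) :
    ∀ᵐ ω ∂P, Tendsto (fun k => (entersBefore φ δ r).indicator 1 (fun t => X z t ω)
        * ψ (X z (gridEntry φ δ k (fun t => X z t ω) + u) ω)) atTop
      (𝓝 ((entersBefore φ δ r).indicator 1 (fun t => X z t ω)
        * ψ (X z (entry φ δ (fun t => X z t ω) + u) ω))) := by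
  filter_upwards [hX.cadlag z] with ω hω
  refine Tendsto.const_mul _ ((hψ.tendsto _).comp (hω.tendsto_of_ge (fun k => ?_) ?_))
  · exact add_le_add_left (entry_le_gridEntry φ δ k _) u
  · exact (FeynmanKac.tendsto_gridEntry φ δ _).add_const u

lemma abs_indicator_one_mul_le {α : Type*} (A : Set α) (x : α) {a C : ℝ} (h : |a| ≤ C) :
    |A.indicator 1 x * a| ≤ C := by
  by_cases hx : x ∈ A
  · simpa [hx] using h
  · simpa [hx] using (abs_nonneg a).trans h

lemma IsCadlagStrongMarkov.aestronglyMeasurable_gridEntry [BorelSpace S] [IsProbabilityMeasure P]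
    (hX : IsCadlagStrongMarkov P 𝓕 X)
    {φ : S → ℝ} (hφ : Continuous φ) (δ : ℝ) (z : S) (r u : ℝ≥0) (k : ℕ) {ψ : S → ℝ}
    (hψ : IsBoundedMeasurable ψ) :
    AEStronglyMeasurable (fun ω => (entersBefore φ δ r).indicator 1 (fun t => X z t ω)
        * ψ (X z (gridEntry φ δ k (fun t => X z t ω) + u) ω)) P :=
  (integrable_finsetSum _ fun j _ =>
    hX.integrable_entersIn hφ δ z r u k j hψ).aestronglyMeasurable.congr
      (hX.ae_sum_entersIn hφ δ z r u k ψ)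

lemma IsCadlagStrongMarkov.aestronglyMeasurable_entry [BorelSpace S] [IsProbabilityMeasure P]
    (hX : IsCadlagStrongMarkov P 𝓕 X)
    {φ : S → ℝ} (hφ : Continuous φ) (δ : ℝ) (z : S) (r u : ℝ≥0) {ψ : S → ℝ}
    (hψc : Continuous ψ) {C : ℝ} (hC : ∀ y, |ψ y| ≤ C) :
    AEStronglyMeasurable (fun ω => (entersBefore φ δ r).indicator 1 (fun t => X z t ω)
        * ψ (X z (entry φ δ (fun t => X z t ω) + u) ω)) P :=
  aestronglyMeasurable_of_tendsto_ae atTop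
    (fun k => hX.aestronglyMeasurable_gridEntry hφ δ z r u k ⟨hψc.measurable, C, hC⟩)
    (hX.tendsto_gridEntry δ z r u hψc)

/-- The strong Markov property at the entrance time into an open set. -/
lemma IsCadlagStrongMarkov.markov_entry [BorelSpace S] [IsProbabilityMeasure P]
    (hX : IsCadlagStrongMarkov P 𝓕 X) {φ : S → ℝ}
    (hφ : Continuous φ) (δ : ℝ) (z : S) (r u : ℝ≥0) {g : S → ℝ} (hgc : Continuous g)
    {C : ℝ} (hC : ∀ y, |g y| ≤ C) (hU : Continuous (transition P X u g)) :
    ∫ ω, (entersBefore φ δ r).indicator 1 (fun t => X z t ω)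
        * g (X z (entry φ δ (fun t => X z t ω) + u) ω) ∂P
      = ∫ ω, (entersBefore φ δ r).indicator 1 (fun t => X z t ω)
        * transition P X u g (X z (entry φ δ (fun t => X z t ω)) ω) ∂P := by
  have hCU := abs_transition_le (P := P) X u hC
  have h1 := tendsto_integral_of_dominated_convergence (fun _ => C)
    (fun k => hX.aestronglyMeasurable_gridEntry hφ δ z r u k ⟨hgc.measurable, C, hC⟩)
    (integrable_const C)
    (fun k => ae_of_all _ fun ω => abs_indicator_one_mul_le _ _ (hC _))
    (hX.tendsto_gridEntry δ z r u hgc)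
  -- Continuity of `transition P X u g` is what lets the grid times decrease to the entrance time on
  -- this side.
  have h2 := tendsto_integral_of_dominated_convergence (fun _ => C)
    (fun k => hX.aestronglyMeasurable_gridEntry hφ δ z r 0 k ⟨hU.measurable, C, hCU⟩)
    (integrable_const C)
    (fun k => ae_of_all _ fun ω => abs_indicator_one_mul_le _ _ (hCU _))
    (hX.tendsto_gridEntry δ z r 0 hU)
  simp only [add_zero] at h2
  refine tendsto_nhds_unique h1 (h2.congr fun k => ?_)
  exact (hX.markov_gridEntry hφ δ z r u k ⟨hgc.measurable, C, hC⟩).symm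

end StrongMarkov

/-! ### Paths approaching the zero set -/

section Path

variable {S : Type*} [TopologicalSpace S] {x : ℝ≥0 → S} {φ : S → ℝ} {r : ℝ≥0}

/-- The first time at which the path reaches the zero set of `φ`, in the limit from the left or
as a value. -/
noncomputable def approachTime (φ : S → ℝ) (x : ℝ≥0 → S) : ℝ≥0 :=
  ⨆ n : ℕ, entry φ (1 / ((n : ℝ) + 1)) x

/-- The paths that come arbitrarily close to the zero set of `φ` before `r`. -/
def approaches (φ : S → ℝ) (r : ℝ≥0) : Set (ℝ≥0 → S) :=
  ⋂ n : ℕ, entersBefore φ (1 / ((n : ℝ) + 1)) r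

lemma antitone_entersBefore {S : Type*} (φ : S → ℝ) (r : ℝ≥0) :
    Antitone fun n : ℕ => entersBefore φ (1 / ((n : ℝ) + 1)) r := by
  rintro m n hmn x ⟨i, hi, h⟩
  exact ⟨i, hi, h.trans_le (one_div_le_one_div_of_le (by positivity) (by gcongr))⟩

lemma tendsto_indicator_entersBefore {S : Type*} (φ : S → ℝ) (r : ℝ≥0) (x : ℝ≥0 → S) :
    Tendsto (fun n : ℕ => (entersBefore φ (1 / ((n : ℝ) + 1)) r).indicator (1 : (ℝ≥0 → S) → ℝ) x)
      atTop
      (𝓝 ((approaches φ r).indicator 1 x)) :=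
  ((antitone_entersBefore φ r).tendsto_indicator _ 1 x).mono_right (pure_le_nhds _)

lemma IsCadlag.nonempty_of_mem_approaches (hx : IsCadlag x) (hφ : Continuous φ)
    (hxr : x ∈ approaches φ r) (n : ℕ) :
    {s | φ (x s) < 1 / ((n : ℝ) + 1)}.Nonempty :=
  ((hx.mem_entersBefore_iff_entry hφ _ r).1 (mem_iInter.1 hxr n)).1

lemma IsCadlag.entry_lt_of_mem_approaches (hx : IsCadlag x) (hφ : Continuous φ)
    (hxr : x ∈ approaches φ r) (n : ℕ) : entry φ (1 / ((n : ℝ) + 1)) x < r :=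
  ((hx.mem_entersBefore_iff_entry hφ _ r).1 (mem_iInter.1 hxr n)).2

/-- Approach is essential here: the default `entry = 0` of a path that never enters would break
monotonicity. -/
lemma IsCadlag.monotone_entry (hx : IsCadlag x) (hφ : Continuous φ)
    (hxr : x ∈ approaches φ r) : Monotone fun n : ℕ => entry φ (1 / ((n : ℝ) + 1)) x := by
  intro m n hmn
  refine csInf_le_csInf (OrderBot.bddBelow _) (hx.nonempty_of_mem_approaches hφ hxr n) ?_
  intro s hs
  exact lt_of_lt_of_le (show φ (x s) < 1 / ((n : ℝ) + 1) from hs)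
    (one_div_le_one_div_of_le (by positivity) (by gcongr))

lemma IsCadlag.bddAbove_entry (hx : IsCadlag x) (hφ : Continuous φ)
    (hxr : x ∈ approaches φ r) :
    BddAbove (range fun n : ℕ => entry φ (1 / ((n : ℝ) + 1)) x) := by
  refine ⟨r, ?_⟩
  rintro _ ⟨n, rfl⟩
  exact (hx.entry_lt_of_mem_approaches hφ hxr n).le

lemma IsCadlag.tendsto_entry (hx : IsCadlag x) (hφ : Continuous φ)
    (hxr : x ∈ approaches φ r) :
    Tendsto (fun n : ℕ => entry φ (1 / ((n : ℝ) + 1)) x) atTop (𝓝 (approachTime φ x)) :=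
  tendsto_atTop_ciSup (hx.monotone_entry hφ hxr) (hx.bddAbove_entry hφ hxr)

lemma IsCadlag.approachTime_le (hx : IsCadlag x) (hφ : Continuous φ)
    (hxr : x ∈ approaches φ r) : approachTime φ x ≤ r :=
  ciSup_le fun n => (hx.entry_lt_of_mem_approaches hφ hxr n).le

lemma IsCadlag.entry_le_approachTime (hx : IsCadlag x) (hφ : Continuous φ)
    (hxr : x ∈ approaches φ r) (n : ℕ) :
    entry φ (1 / ((n : ℝ) + 1)) x ≤ approachTime φ x :=
  le_ciSup (hx.bddAbove_entry hφ hxr) n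

/-- The times increase, so the limit is either a left limit or an eventually constant value. -/
lemma IsCadlag.tendsto_limUnder_entry (hx : IsCadlag x) (hφ : Continuous φ)
    (hxr : x ∈ approaches φ r) (u : ℝ≥0) :
    Tendsto (fun n : ℕ => x (entry φ (1 / ((n : ℝ) + 1)) x + u)) atTop
      (𝓝 (@limUnder _ _ _ ⟨x 0⟩ atTop
        fun n : ℕ => x (entry φ (1 / ((n : ℝ) + 1)) x + u))) :=
  tendsto_nhds_limUnder (hx.exists_tendsto_of_monotone
    ((hx.monotone_entry hφ hxr).add_const u) ((hx.tendsto_entry hφ hxr).add_const u))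

lemma IsCadlag.apply_limit_entry_eq_zero (hx : IsCadlag x) (hφ : Continuous φ)
    (hxr : x ∈ approaches φ r) (hφ0 : ∀ y, 0 ≤ φ y) {l : S}
    (hl : Tendsto (fun n : ℕ => x (entry φ (1 / ((n : ℝ) + 1)) x)) atTop (𝓝 l)) : φ l = 0 := by
  refine le_antisymm ?_ (hφ0 l)
  exact le_of_tendsto_of_tendsto' ((hφ.tendsto l).comp hl)
    tendsto_one_div_add_atTop_nhds_zero_nat
    fun n => hx.apply_entry_le hφ (hx.nonempty_of_mem_approaches hφ hxr n)

/-- The values of a continuous function shortly after the entrance times approach its value at the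
limit time. -/
lemma IsCadlag.tendsto_limit_entry_add (hx : IsCadlag x) (hφ : Continuous φ)
    (hxr : x ∈ approaches φ r) {g : S → ℝ} (hg : Continuous g) {Z : ℝ≥0 → S}
    (hZ : ∀ u, Tendsto (fun n : ℕ => x (entry φ (1 / ((n : ℝ) + 1)) x + u)) atTop (𝓝 (Z u))) :
    Tendsto (fun m : ℕ => g (Z (1 / ((m : ℝ≥0) + 1)))) atTop
      (𝓝 (g (x (approachTime φ x)))) := by
  rw [Metric.tendsto_nhds]
  intro ε hε
  have h1 : ∀ᶠ s in 𝓝[≥] (approachTime φ x),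
      dist (g (x s)) (g (x (approachTime φ x))) < ε / 2 :=
    ((hg.tendsto _).comp (hx.continuousWithinAt _)).eventually
      (Metric.ball_mem_nhds _ (half_pos hε))
  obtain ⟨b, hb, hsub⟩ := mem_nhdsGE_iff_exists_Ico_subset.1 h1
  have h2 : Tendsto (fun m : ℕ => approachTime φ x + 1 / ((m : ℝ≥0) + 1)) atTop
      (𝓝 (approachTime φ x + 0)) :=
    tendsto_const_nhds.add tendsto_one_div_add_atTop_nhds_zero_nat
  rw [add_zero] at h2
  filter_upwards [h2.eventually (gt_mem_nhds hb)] with m hm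
  refine lt_of_le_of_lt ?_ (half_lt_self hε)
  have hlim := ((hg.tendsto _).comp (hZ (1 / ((m : ℝ≥0) + 1)))).dist
    (tendsto_const_nhds (x := g (x (approachTime φ x))))
  refine le_of_tendsto hlim ?_
  have hpos : (0 : ℝ≥0) < 1 / ((m : ℝ≥0) + 1) := by positivity
  -- For large `n` the shifted entrance time lies strictly between `approachTime φ x` and `b`, where
  -- right-continuity controls the path.
  have h3 : Tendsto (fun n : ℕ => entry φ (1 / ((n : ℝ) + 1)) x + 1 / ((m : ℝ≥0) + 1)) atTop
      (𝓝 (approachTime φ x + 1 / ((m : ℝ≥0) + 1))) := (hx.tendsto_entry hφ hxr).add_const _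
  filter_upwards [h3.eventually (lt_mem_nhds (lt_add_of_pos_right _ hpos))] with n hn
  have hlt : dist (g (x (entry φ (1 / ((n : ℝ) + 1)) x + 1 / ((m : ℝ≥0) + 1))))
      (g (x (approachTime φ x))) < ε / 2 :=
    hsub ⟨hn.le, (add_le_add_left (hx.entry_le_approachTime hφ hxr n) _).trans_lt hm⟩
  exact hlt.le

end Path

/-! ### Quasi-left-continuity -/

section QuasiLeftContinuity

variable {Ω S : Type*} [mΩ : MeasurableSpace Ω] [MeasurableSpace S] [TopologicalSpace S]
  {P : Measure Ω} {𝓕 : S → Filtration ℝ≥0 mΩ} {X : S → ℝ≥0 → Ω → S}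

lemma IsCadlagStrongMarkov.tendsto_transition_zero [OpensMeasurableSpace S]
    [IsProbabilityMeasure P] (hX : IsCadlagStrongMarkov P 𝓕 X) {g : S → ℝ} (hg : Continuous g)
    {C : ℝ} (hC : ∀ y, |g y| ≤ C) (y : S) :
    Tendsto (fun m : ℕ => transition P X (1 / ((m : ℝ≥0) + 1)) g y) atTop (𝓝 (g y)) := by
  have h := tendsto_integral_of_dominated_convergence (μ := P) (f := fun _ => g y)
    (F := fun (m : ℕ) ω => g (X y (1 / ((m : ℝ≥0) + 1)) ω)) (fun _ => C)
    (fun m => (hg.measurable.comp (hX.measurable y _)).aestronglyMeasurable)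
    (integrable_const C) (fun m => ae_of_all _ fun ω => hC _) (by
      filter_upwards [hX.cadlag y, hX.start y] with ω hω h0
      have := (hg.tendsto _).comp (hω.tendsto_of_ge (L := 0)
        (T := fun m : ℕ => 1 / ((m : ℝ≥0) + 1)) (fun _ => zero_le)
        tendsto_one_div_add_atTop_nhds_zero_nat)
      rwa [h0] at this)
  simpa [transition] using h

/-- Quasi-left-continuity: almost surely, a path that comes arbitrarily close to the zero set of
`φ` before `r` reaches it by time `r`. -/
lemma IsCadlagStrongMarkov.ae_exists_eq_zero [BorelSpace S] [IsProbabilityMeasure P]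
    (hX : IsCadlagStrongMarkov P 𝓕 X)
    (hSF : ∀ t : ℝ≥0, 0 < t → ∀ f : S → ℝ, IsBoundedMeasurable f → Continuous (transition P X t f))
    {φ : S → ℝ} (hφ : Continuous φ) (hφ0 : ∀ y, 0 ≤ φ y) (z : S) (r : ℝ≥0) :
    ∀ᵐ ω ∂P, (fun t => X z t ω) ∈ approaches φ r → ∃ s ≤ r, φ (X z s ω) = 0 := by
  have hne : Nonempty S := ⟨z⟩
  set x : Ω → ℝ≥0 → S := fun ω t => X z t ω with hxdef
  -- `Z u` is the limit of `X_{T_n + u}` for the entrance times `T_n`; it is meaningful on the event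
  -- of approach.
  set Z : ℝ≥0 → Ω → S := fun u ω =>
    limUnder atTop fun n : ℕ => x ω (entry φ (1 / ((n : ℝ) + 1)) (x ω) + u) with hZdef
  have hZ : ∀ ω, IsCadlag (x ω) → x ω ∈ approaches φ r → ∀ u,
      Tendsto (fun n : ℕ => x ω (entry φ (1 / ((n : ℝ) + 1)) (x ω) + u)) atTop (𝓝 (Z u ω)) :=
    fun ω hω hH u => hω.tendsto_limUnder_entry hφ hH u
  have hlim : ∀ (u : ℝ≥0) (ψ : S → ℝ), Continuous ψ → ∀ᵐ ω ∂P,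
      Tendsto (fun n : ℕ => (entersBefore φ (1 / ((n : ℝ) + 1)) r).indicator 1 (x ω)
        * ψ (x ω (entry φ (1 / ((n : ℝ) + 1)) (x ω) + u))) atTop
        (𝓝 ((approaches φ r).indicator 1 (x ω) * ψ (Z u ω))) := by
    intro u ψ hψ
    filter_upwards [hX.cadlag z] with ω hω
    by_cases hH : x ω ∈ approaches φ r
    · exact (tendsto_indicator_entersBefore φ r _).mul ((hψ.tendsto _).comp (hZ ω hω hH u))
    · have h := tendsto_indicator_entersBefore φ r (x ω)
      rw [indicator_of_notMem hH] at h ⊢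
      rw [zero_mul]
      obtain ⟨N, hN⟩ : ∃ N : ℕ, x ω ∉ entersBefore φ (1 / ((N : ℝ) + 1)) r := by
        simpa [approaches] using hH
      refine tendsto_const_nhds.congr' ?_
      filter_upwards [eventually_ge_atTop N] with n hn
      rw [indicator_of_notMem fun h => hN (antitone_entersBefore φ r hn h), zero_mul]
  have hmeas : ∀ (u : ℝ≥0) (ψ : S → ℝ) (C : ℝ), Continuous ψ → (∀ y, |ψ y| ≤ C) →
      AEStronglyMeasurable
        (fun ω => (approaches φ r).indicator 1 (x ω) * ψ (Z u ω)) P :=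
    fun u ψ C hψ hC => aestronglyMeasurable_of_tendsto_ae atTop
      (fun n : ℕ => hX.aestronglyMeasurable_entry hφ (1 / ((n : ℝ) + 1)) z r u hψ hC)
      (hlim u ψ hψ)
  have hint : ∀ (u : ℝ≥0) (ψ : S → ℝ) (C : ℝ), Continuous ψ → (∀ y, |ψ y| ≤ C) →
      Tendsto (fun n : ℕ => ∫ ω, (entersBefore φ (1 / ((n : ℝ) + 1)) r).indicator 1 (x ω)
        * ψ (x ω (entry φ (1 / ((n : ℝ) + 1)) (x ω) + u)) ∂P) atTop
        (𝓝 (∫ ω, (approaches φ r).indicator 1 (x ω) * ψ (Z u ω) ∂P)) :=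
    fun u ψ C hψ hC => tendsto_integral_of_dominated_convergence (fun _ => C)
      (fun n => hX.aestronglyMeasurable_entry hφ _ z r u hψ hC) (integrable_const C)
      (fun n => ae_of_all _ fun ω => abs_indicator_one_mul_le _ _ (hC _)) (hlim u ψ hψ)
  -- Truncation makes `φ` bounded without changing its zero set.
  set g : S → ℝ := fun y => min (φ y) 1 with hgdef
  have hg : Continuous g := hφ.min continuous_const
  have hg0 : ∀ y, 0 ≤ g y := fun y => le_min (hφ0 y) zero_le_one
  have hg1 : ∀ y, |g y| ≤ 1 := fun y => by
    rw [abs_of_nonneg (hg0 y)]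
    exact min_le_right _ _
  have hU : ∀ u : ℝ≥0, 0 < u → Continuous (transition P X u g) := fun u hu =>
    hSF u hu g ⟨hg.measurable, 1, hg1⟩
  -- The limit `n → ∞` of the strong Markov property at the entrance times.
  have hmarkov : ∀ u : ℝ≥0, 0 < u →
      ∫ ω, (approaches φ r).indicator 1 (x ω) * g (Z u ω) ∂P
        = ∫ ω, (approaches φ r).indicator 1 (x ω) * transition P X u g (Z 0 ω) ∂P := by
    intro u hu
    refine tendsto_nhds_unique (hint u g 1 hg hg1)
      ((hint 0 _ 1 (hU u hu) (abs_transition_le X u hg1)).congr fun n => ?_)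
    simp only [add_zero]
    exact (hX.markov_entry hφ _ z r u hg hg1 (hU u hu)).symm
  have hpos : ∀ m : ℕ, (0 : ℝ≥0) < 1 / ((m : ℝ≥0) + 1) := fun m => by positivity
  have hL : ∀ᵐ ω ∂P, Tendsto (fun m : ℕ => (approaches φ r).indicator 1 (x ω)
      * g (Z (1 / ((m : ℝ≥0) + 1)) ω)) atTop
      (𝓝 ((approaches φ r).indicator 1 (x ω) * g (x ω (approachTime φ (x ω))))) := by
    filter_upwards [hX.cadlag z] with ω hω
    by_cases hH : x ω ∈ approaches φ r
    · exact (hω.tendsto_limit_entry_add hφ hH hg (Z := fun u => Z u ω) (hZ ω hω hH)).const_mul _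
    · simp [hH]
  have hLmeas := aestronglyMeasurable_of_tendsto_ae atTop
    (fun m : ℕ => hmeas (1 / ((m : ℝ≥0) + 1)) g 1 hg hg1) hL
  have hLint := tendsto_integral_of_dominated_convergence (fun _ => (1 : ℝ))
    (fun m : ℕ => hmeas (1 / ((m : ℝ≥0) + 1)) g 1 hg hg1) (integrable_const 1)
    (fun m => ae_of_all _ fun ω => abs_indicator_one_mul_le _ _ (hg1 _)) hL
  have hRint := tendsto_integral_of_dominated_convergence (fun _ => (1 : ℝ))
    (fun m : ℕ => hmeas 0 _ 1 (hU _ (hpos m)) (abs_transition_le X _ hg1)) (integrable_const 1)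
    (fun m => ae_of_all _ fun ω =>
      abs_indicator_one_mul_le _ _ (abs_transition_le X _ hg1 _))
    (ae_of_all P fun ω =>
      (hX.tendsto_transition_zero hg hg1 (Z 0 ω)).const_mul ((approaches φ r).indicator 1 (x ω)))
  have hzero : ∫ ω, (approaches φ r).indicator 1 (x ω) * g (Z 0 ω) ∂P = 0 := by
    refine integral_eq_zero_of_ae ?_
    filter_upwards [hX.cadlag z] with ω hω
    by_cases hH : x ω ∈ approaches φ r
    · have h0 := hZ ω hω hH 0
      simp only [add_zero] at h0
      simp [hgdef, hω.apply_limit_entry_eq_zero hφ hH hφ0 h0]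
    · simp [hH]
  -- Now `u = 1 / (m + 1) → 0`: one side tends to the value at `approachTime`, the other to the
  -- value at `Z 0`, where `φ` vanishes.
  have hfin : ∫ ω, (approaches φ r).indicator 1 (x ω) * g (x ω (approachTime φ (x ω))) ∂P = 0 := by
    rw [← hzero]
    exact tendsto_nhds_unique hLint (hRint.congr fun m => (hmarkov _ (hpos m)).symm)
  rw [integral_eq_zero_iff_of_nonneg_ae] at hfin
  · filter_upwards [hX.cadlag z, hfin] with ω hω h hH
    refine ⟨approachTime φ (x ω), hω.approachTime_le hφ hH, ?_⟩
    rw [indicator_of_mem hH, Pi.one_apply, one_mul, Pi.zero_apply] at h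
    rcases min_choice (φ (x ω (approachTime φ (x ω)))) 1 with h' | h'
    · exact h'.symm.trans h
    · exact absurd (h'.symm.trans h) one_ne_zero
  · exact ae_of_all _ fun ω => mul_nonneg (indicator_nonneg (fun _ _ => zero_le_one) _) (hg0 _)
  · exact Integrable.of_bound hLmeas 1
      (ae_of_all _ fun ω => abs_indicator_one_mul_le _ _ (hg1 _))

end QuasiLeftContinuity

/-! ### Strong Feller property without killing -/

section StrongFeller

/-- If `Y n → Y` almost surely and the laws converge setwise, then `f (Y n) → f Y` in `L¹` for all
bounded measurable `f`. -/
lemma tendsto_integral_abs_sub_of_setwise {Ω S : Type*} [MeasurableSpace Ω] {P : Measure Ω}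
    [IsProbabilityMeasure P] [TopologicalSpace S] [TopologicalSpace.PseudoMetrizableSpace S]
    [MeasurableSpace S] [BorelSpace S] {Y : ℕ → Ω → S} {Y' : Ω → S} (hY : ∀ n, Measurable (Y n))
    (hY' : Measurable Y') (hlim : ∀ᵐ ω ∂P, Tendsto (fun n => Y n ω) atTop (𝓝 (Y' ω)))
    (hset : ∀ f : S → ℝ, IsBoundedMeasurable f →
      Tendsto (fun n => ∫ ω, f (Y n ω) ∂P) atTop (𝓝 (∫ ω, f (Y' ω) ∂P)))
    {f : S → ℝ} (hf : IsBoundedMeasurable f) :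
    Tendsto (fun n => ∫ ω, |f (Y n ω) - f (Y' ω)| ∂P) atTop (𝓝 0) := by
  have hbi : ∀ {W : Ω → S}, Measurable W → ∀ {k : S → ℝ}, IsBoundedMeasurable k →
      Integrable (fun ω => k (W ω)) P := fun hW k ⟨hkm, C, hC⟩ =>
    Integrable.of_bound (hkm.comp hW).aestronglyMeasurable C (ae_of_all _ fun ω => hC _)
  have hfm := hf.1
  obtain ⟨C, hC⟩ := hf.2
  have : IsProbabilityMeasure (P.map Y') := Measure.isProbabilityMeasure_map hY'.aemeasurable
  have hfint : Integrable f (P.map Y') :=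
    Integrable.of_bound hfm.aestronglyMeasurable C (ae_of_all _ hC)
  rw [Metric.tendsto_atTop]
  intro ε hε
  obtain ⟨g, hg, -⟩ := hfint.exists_boundedContinuous_integral_sub_le (by positivity : 0 < ε / 4)
  have hgb : IsBoundedMeasurable g := ⟨g.continuous.measurable, ‖g‖, fun y => g.norm_coe_le_norm y⟩
  have hh : IsBoundedMeasurable fun y => |f y - g y| :=
    ⟨(hfm.sub hgb.1).abs, C + ‖g‖, fun y => by
      rw [abs_abs]
      exact (abs_sub _ _).trans (add_le_add (hC y) (g.norm_coe_le_norm y))⟩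
  have hh' : ∫ ω, |f (Y' ω) - g (Y' ω)| ∂P ≤ ε / 4 := by
    have h := integral_map (μ := P) hY'.aemeasurable (f := fun y => ‖f y - g y‖)
      (hfm.sub hgb.1).norm.aestronglyMeasurable
    exact h.symm.trans_le hg
  -- Setwise convergence carries the approximation error over to `Y n`, at the price of `ε / 2`
  -- instead of `ε / 4`.
  have h1 : ∀ᶠ n in atTop, ∫ ω, |f (Y n ω) - g (Y n ω)| ∂P < ε / 2 :=
    (hset _ hh).eventually (gt_mem_nhds (hh'.trans_lt (by linarith)))
  have h2 : Tendsto (fun n => ∫ ω, |g (Y n ω) - g (Y' ω)| ∂P) atTop (𝓝 (∫ _, (0 : ℝ) ∂P)) := by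
    refine tendsto_integral_of_dominated_convergence (fun _ => ‖g‖ + ‖g‖)
      (fun n => ((hgb.1.comp (hY n)).sub (hgb.1.comp hY')).abs.aestronglyMeasurable)
      (integrable_const _) (fun n => ae_of_all _ fun ω => ?_) ?_
    · rw [Real.norm_eq_abs, abs_abs]
      exact (abs_sub _ _).trans (add_le_add (g.norm_coe_le_norm _) (g.norm_coe_le_norm _))
    · filter_upwards [hlim] with ω hω
      have := (((g.continuous.tendsto _).comp hω).sub_const (g (Y' ω))).abs
      simpa using this
  rw [integral_zero] at h2
  obtain ⟨N, hN⟩ := eventually_atTop.1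
    (h1.and (h2.eventually (gt_mem_nhds (by positivity : 0 < ε / 4))))
  refine ⟨N, fun n hn => ?_⟩
  obtain ⟨hn1, hn2⟩ := hN n hn
  have i1 := hbi (hY n) hh
  have i2 : Integrable (fun ω => |g (Y n ω) - g (Y' ω)|) P :=
    ((hbi (hY n) hgb).sub (hbi hY' hgb)).abs
  have i3 := hbi hY' hh
  have hle : ∫ ω, |f (Y n ω) - f (Y' ω)| ∂P
      ≤ ∫ ω, (|f (Y n ω) - g (Y n ω)| + |g (Y n ω) - g (Y' ω)| + |f (Y' ω) - g (Y' ω)|) ∂P := by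
    refine integral_mono ((hbi (hY n) hf).sub (hbi hY' hf)).abs ((i1.add i2).add i3) fun ω => ?_
    simp only
    rw [abs_sub_comm (f (Y' ω))]
    calc |f (Y n ω) - f (Y' ω)|
        = |f (Y n ω) - g (Y n ω) + (g (Y n ω) - g (Y' ω)) + (g (Y' ω) - f (Y' ω))| := by ring_nf
      _ ≤ _ := abs_add_three _ _ _
  have hsum : ∫ ω, (|f (Y n ω) - g (Y n ω)| + |g (Y n ω) - g (Y' ω)| + |f (Y' ω) - g (Y' ω)|) ∂P
      = ∫ ω, |f (Y n ω) - g (Y n ω)| ∂P + ∫ ω, |g (Y n ω) - g (Y' ω)| ∂P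
        + ∫ ω, |f (Y' ω) - g (Y' ω)| ∂P := by
    rw [← integral_add i1 i2]
    exact integral_add (i1.add i2) i3
  rw [Real.dist_eq, sub_zero, abs_of_nonneg (integral_nonneg fun _ => abs_nonneg _)]
  linarith

variable {Ω S : Type*} [mΩ : MeasurableSpace Ω] [MeasurableSpace S] [MetricSpace S]
  {P : Measure Ω} {𝓕 : S → Filtration ℝ≥0 mΩ} {X : S → ℝ≥0 → Ω → S} {V : S → ℝ} {c : ℝ}

lemma IsCadlagStrongMarkov.ae_weight_eq (hX : IsCadlagStrongMarkov P 𝓕 X) (hV : Continuous V)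
    (hc : ∀ y, -c ≤ V y) {z : S} {t : ℝ≥0}
    (hint : ∀ᵐ ω ∂P, IntervalIntegrable (fun s : ℝ => V (X z s.toNNReal ω)) volume 0 (t : ℝ)) :
    ∀ᵐ ω ∂P, Real.exp (-potentialIntegral X V z t ω) = weight V c t fun u => X z u ω := by
  filter_upwards [hX.cadlag z, hint] with ω hω hi
  exact (hω.weight_eq hV hc hi).symm

/-- The non-killed Feynman-Kac semigroup is strongly Feller. -/
lemma IsCadlagStrongMarkov.continuous_feynmanKac [BorelSpace S] [IsProbabilityMeasure P]
    (hX : IsCadlagStrongMarkov P 𝓕 X) (hV : Continuous V) (hc : ∀ y, -c ≤ V y) {t : ℝ≥0}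
    (hint : ∀ z, ∀ᵐ ω ∂P,
      IntervalIntegrable (fun s : ℝ => V (X z s.toNNReal ω)) volume 0 (t : ℝ))
    (hSF : ∀ f : S → ℝ, IsBoundedMeasurable f → Continuous (transition P X t f))
    (hP : ∀ z, TendstoInMeasure P (fun z' => X z' t) (𝓝 z) (X z t))
    (hIV : ∀ (z : S) (zs : ℕ → S), Tendsto zs atTop (𝓝 z) →
      TendstoInMeasure P (fun n => potentialIntegral X V (zs n) t) atTop
        (potentialIntegral X V z t))
    {f : S → ℝ} (hf : IsBoundedMeasurable f) : Continuous (feynmanKac P X V t f) := by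
  refine continuous_iff_continuousAt.2 fun z => tendsto_of_subseq_tendsto fun ns hns => ?_
  -- Two successive extractions turn convergence in probability of the positions and of the
  -- integrals into almost sure convergence.
  obtain ⟨ms, hms, hX1⟩ := TendstoInMeasure.exists_seq_tendsto_ae
    (f := fun n => X (ns n) t) (g := X z t) fun ε hε => (hP z ε hε).comp hns
  obtain ⟨ks, hks, hI⟩ := (hIV z (fun n => ns (ms n))
    (hns.comp hms.tendsto_atTop)).exists_seq_tendsto_ae
  refine ⟨fun n => ms (ks n), ?_⟩
  set zs : ℕ → S := fun n => ns (ms (ks n)) with hzs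
  have hzs' : Tendsto zs atTop (𝓝 z) := hns.comp (hms.tendsto_atTop.comp hks.tendsto_atTop)
  have hX2 : ∀ᵐ ω ∂P, Tendsto (fun n => X (zs n) t ω) atTop (𝓝 (X z t ω)) := by
    filter_upwards [hX1] with ω hω
    exact hω.comp hks.tendsto_atTop
  set J : S → Ω → ℝ := fun y ω => Real.exp (-potentialIntegral X V y t ω) with hJdef
  have hJeq : ∀ y, (fun ω => weight V c t fun u => X y u ω) =ᵐ[P] J y := fun y => by
    filter_upwards [hX.ae_weight_eq hV hc (hint y)] with ω hω
    exact hω.symm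
  have hJm : ∀ y, AEStronglyMeasurable (J y) P := fun y =>
    (measurable_weight hV.measurable c t fun u _ => hX.measurable y u).aestronglyMeasurable.congr
      (hJeq y)
  have hJb : ∀ y, ∀ᵐ ω ∂P, |J y ω| ≤ Real.exp (c * t) := fun y => by
    filter_upwards [hJeq y] with ω hω
    rw [← hω]
    exact abs_weight_le V c t _
  have hJlim : ∀ᵐ ω ∂P, Tendsto (fun n => J (zs n) ω) atTop (𝓝 (J z ω)) := by
    filter_upwards [hI] with ω hω
    exact (Real.continuous_exp.tendsto _).comp hω.neg
  obtain ⟨C, hC⟩ := hf.2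
  have hfm : ∀ y, AEStronglyMeasurable (fun ω => f (X y t ω)) P := fun y =>
    (hf.1.comp (hX.measurable y t)).aestronglyMeasurable
  have hf0 := tendsto_integral_abs_sub_of_setwise (fun n => hX.measurable (zs n) t)
    (hX.measurable z t) hX2 (fun g hg => ((hSF g hg).tendsto z).comp hzs') hf
  have hmul : ∀ y y', Integrable (fun ω => f (X y t ω) * J y' ω) P := fun y y' => by
    refine Integrable.of_bound ((hfm y).mul (hJm y')) (C * Real.exp (c * t)) ?_
    filter_upwards [hJb y'] with ω hω
    rw [norm_mul]
    exact mul_le_mul (hC _) hω (norm_nonneg _) ((abs_nonneg _).trans (hC z))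
  -- With `J` the weight, the product is split as `(f (X_n) - f (X)) J_n + f (X) J_n`; the first
  -- term is small in `L¹`, the second is handled by domination.
  have hA : Tendsto (fun n => ∫ ω, (f (X (zs n) t ω) - f (X z t ω)) * J (zs n) ω ∂P) atTop
      (𝓝 0) := by
    have hb := hf0.mul_const (Real.exp (c * t))
    rw [zero_mul] at hb
    refine squeeze_zero_norm (fun n => ?_) hb
    have hdint : Integrable (fun ω => |f (X (zs n) t ω) - f (X z t ω)|) P :=
      (Integrable.of_bound ((hfm _).sub (hfm _)) (C + C) (ae_of_all _ fun ω =>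
        (abs_sub _ _).trans (add_le_add (hC _) (hC _)))).abs
    rw [← integral_mul_const]
    refine norm_integral_le_of_norm_le (hdint.mul_const _) ?_
    filter_upwards [hJb (zs n)] with ω hω
    rw [norm_mul]
    exact mul_le_mul_of_nonneg_left hω (norm_nonneg _)
  have hB : Tendsto (fun n => ∫ ω, f (X z t ω) * J (zs n) ω ∂P) atTop
      (𝓝 (∫ ω, f (X z t ω) * J z ω ∂P)) := by
    refine tendsto_integral_of_dominated_convergence (fun _ => C * Real.exp (c * t))
      (fun n => (hfm z).mul (hJm _)) (integrable_const _) (fun n => ?_) ?_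
    · filter_upwards [hJb (zs n)] with ω hω
      rw [norm_mul]
      exact mul_le_mul (hC _) hω (norm_nonneg _) ((abs_nonneg _).trans (hC z))
    · filter_upwards [hJlim] with ω hω
      exact hω.const_mul _
  have hAB := hA.add hB
  rw [zero_add] at hAB
  refine hAB.congr fun n => ?_
  rw [← integral_add]
  · refine integral_congr_ae (ae_of_all _ fun ω => ?_)
    simp only [hJdef]
    ring
  · simp only [sub_mul]
    exact (hmul _ _).sub (hmul _ _)
  · exact hmul _ _

end StrongFeller

/-! ### Strong Feller property with killing -/

section Killed

/-- A product measurable version of the functional under the expectation in the killed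
Feynman-Kac semigroup. -/
noncomputable def killedFunctional {S : Type*} (V : S → ℝ) (c : ℝ) (φ : S → ℝ) (f : S → ℝ) (t : ℝ≥0)
    (x : ℝ≥0 → S) : ℝ :=
  f (x t) * weight V c t x * (survival φ t).indicator 1 x

lemma isBoundedMeasurable_killedFunctional {S : Type*} [MeasurableSpace S] {V : S → ℝ} {c : ℝ}
    {φ : S → ℝ} (hV : Measurable V) (hφ : Measurable φ) {f : S → ℝ}
    (hf : IsBoundedMeasurable f) (t : ℝ≥0) :
    IsBoundedMeasurable (killedFunctional V c φ f t) := by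
  obtain ⟨hfm, C, hC⟩ := hf
  refine ⟨((hfm.comp (measurable_pi_apply t)).mul (measurable_weight hV c t
    (Y := fun u (x : ℝ≥0 → S) => x u) fun u _ => measurable_pi_apply u)).mul
    (measurable_one.indicator (measurableSet_survival hφ t)), C * Real.exp (c * t), fun x => ?_⟩
  rw [killedFunctional, mul_comm _ (indicator _ _ _)]
  refine abs_indicator_one_mul_le _ _ ?_
  rw [abs_mul]
  exact mul_le_mul (hC _) (abs_weight_le V c t x) (abs_nonneg _) ((abs_nonneg _).trans (hC (x t)))

variable {Ω S : Type*} [mΩ : MeasurableSpace Ω] [MeasurableSpace S] [MetricSpace S]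
  {P : Measure Ω} {𝓕 : S → Filtration ℝ≥0 mΩ} {X : S → ℝ≥0 → Ω → S} {V : S → ℝ} {c : ℝ}
  {D : Set S} {φ : S → ℝ}

/-- The complement of an open set is the zero set of a nonnegative continuous function. -/
lemma exists_continuous_eq_zero_iff {S : Type*} [MetricSpace S] {D : Set S} (hD : IsOpen D) :
    ∃ φ : S → ℝ, Continuous φ ∧ (∀ y, 0 ≤ φ y) ∧ ∀ y, φ y = 0 ↔ y ∉ D := by
  rcases Dᶜ.eq_empty_or_nonempty with h | h
  · refine ⟨fun _ => 1, continuous_const, fun _ => zero_le_one, fun y => ?_⟩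
    simp [compl_empty_iff.1 h]
  · refine ⟨fun y => Metric.infDist y Dᶜ, Metric.continuous_infDist_pt _,
      fun y => Metric.infDist_nonneg, fun y => ?_⟩
    exact (hD.isClosed_compl.mem_iff_infDist_zero h).symm

/-- A right-continuous path has not left an open set by time `t` iff it stays in it on
`[0, t]`. -/
lemma lt_exitTime_iff {Ω S : Type*} [TopologicalSpace S] {X : S → ℝ≥0 → Ω → S} {D : Set S}
    (hD : IsOpen D) {z : S} {ω : Ω} (hω : IsCadlag fun t => X z t ω)
    (t : ℝ≥0) : (t : WithTop ℝ≥0) < exitTime X D z ω ↔ ∀ s ≤ t, X z s ω ∈ D := by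
  constructor
  · intro h s hs
    by_contra hsD
    have h1 : exitTime X D z ω ≤ (s : WithTop ℝ≥0) := hittingAfter_le_of_mem zero_le hsD
    exact absurd (h.trans_le h1) (not_lt.2 (WithTop.coe_le_coe.2 hs))
  · intro h
    by_contra! hle
    unfold exitTime hittingAfter at hle
    split_ifs at hle with hex
    · set A : Set ℝ≥0 := {i | 0 ≤ i ∧ X z i ω ∈ Dᶜ} with hA
      have hne : A.Nonempty := hex
      have hmem : X z (sInf A) ω ∈ D := h _ (WithTop.coe_le_coe.1 hle)
      -- Being in the open set at the infimum would keep the path inside for a while longer, against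
      -- the definition of the infimum.
      have h1 : ∀ᶠ u in 𝓝[≥] (sInf A), X z u ω ∈ D :=
        (hω.continuousWithinAt (sInf A)).eventually (hD.mem_nhds hmem)
      obtain ⟨b, hb, hsub⟩ := mem_nhdsGE_iff_exists_Ico_subset.1 h1
      obtain ⟨s, hs, hsb⟩ := exists_lt_of_csInf_lt hne hb
      have hsD : X z s ω ∈ D := hsub ⟨csInf_le (OrderBot.bddBelow _) hs, hsb⟩
      exact hs.2 hsD
    · exact absurd hle (WithTop.coe_lt_top t).not_ge

/-- Survival prevents an exit on every càdlàg path. Conversely, the two events differ only on paths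
that approach the complement of `D` before `t` without reaching it by `t`, a null set by
quasi-left-continuity. -/
lemma IsCadlagStrongMarkov.ae_lt_exitTime_iff [BorelSpace S] [IsProbabilityMeasure P]
    (hX : IsCadlagStrongMarkov P 𝓕 X)
    (hSF : ∀ t : ℝ≥0, 0 < t → ∀ f : S → ℝ, IsBoundedMeasurable f → Continuous (transition P X t f))
    (hD : IsOpen D) (hφ : Continuous φ) (hφ0 : ∀ y, 0 ≤ φ y) (hφD : ∀ y, φ y = 0 ↔ y ∉ D)
    (z : S) (t : ℝ≥0) :
    ∀ᵐ ω ∂P, (t : WithTop ℝ≥0) < exitTime X D z ω ↔ (fun u => X z u ω) ∈ survival φ t := by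
  have hpos : ∀ y, 0 < φ y ↔ y ∈ D := fun y => by
    rw [(hφ0 y).lt_iff_ne', ne_eq, hφD, not_not]
  filter_upwards [hX.cadlag z, hX.ae_exists_eq_zero hSF hφ hφ0 z t] with ω hω hq
  rw [lt_exitTime_iff hD hω]
  constructor
  · intro h
    refine ⟨(hpos _).2 (h t le_rfl), ?_⟩
    by_contra! hn
    obtain ⟨s, hs, hs0⟩ := hq (mem_iInter.2 hn)
    exact (hφD _).1 hs0 (h s hs)
  · intro h s hs
    obtain ⟨ht, n, hn⟩ := (hω.mem_survival_iff hφ t).1 h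
    rcases hs.eq_or_lt with rfl | hs
    · exact (hpos _).1 ht
    · exact (hpos _).1 (lt_of_lt_of_le (by positivity) (hn s hs))

lemma IsCadlagStrongMarkov.killedFeynmanKac_eq [BorelSpace S] [IsProbabilityMeasure P]
    (hX : IsCadlagStrongMarkov P 𝓕 X) (hV : Continuous V) (hc : ∀ y, -c ≤ V y) {t : ℝ≥0} {z : D}
    (hint : ∀ᵐ ω ∂P,
      IntervalIntegrable (fun s : ℝ => V (X z s.toNNReal ω)) volume 0 (t : ℝ))
    (hsurv : ∀ᵐ ω ∂P,
      (t : WithTop ℝ≥0) < exitTime X D z ω ↔ (fun u => X z u ω) ∈ survival φ t) (f : D → ℝ) :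
    killedFeynmanKac P X V D t f z
      = ∫ ω, killedFunctional V c φ (Function.extend Subtype.val f 0) t (fun u => X z u ω) ∂P := by
  refine integral_congr_ae ?_
  filter_upwards [hX.ae_weight_eq hV hc hint, hsurv] with ω hw hs
  simp only [killedFunctional, hw]
  congr 1
  by_cases h : (fun u => X z u ω) ∈ survival φ t
  · have h' : ω ∈ {ω' | (t : WithTop ℝ≥0) < exitTime X D z ω'} := hs.2 h
    rw [indicator_of_mem h, indicator_of_mem h']
    rfl
  · have h' : ω ∉ {ω' | (t : WithTop ℝ≥0) < exitTime X D z ω'} := fun h' => h (hs.1 h')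
    rw [indicator_of_notMem h, indicator_of_notMem h']

/-- Ignoring the killing during the first `s` units of time changes the killed expectation by at
most a multiple of the probability of an exit before `s`. -/
lemma IsCadlagStrongMarkov.abs_sub_feynmanKac_le [BorelSpace S] [IsProbabilityMeasure P]
    (hX : IsCadlagStrongMarkov P 𝓕 X) (hV : Continuous V) (hc : ∀ y, -c ≤ V y)
    (hφ : Continuous φ) {f : S → ℝ} (hfm : Measurable f) {C : ℝ} (hC : ∀ y, |f y| ≤ C)
    (s u : ℝ≥0) (z : S)
    (hint : ∀ r : ℝ≥0, ∀ᵐ ω ∂P,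
      IntervalIntegrable (fun s : ℝ => V (X z s.toNNReal ω)) volume 0 (r : ℝ))
    (hsurv : ∀ᵐ ω ∂P,
      (s : WithTop ℝ≥0) < exitTime X D z ω ↔ (fun u => X z u ω) ∈ survival φ s) :
    |∫ ω, killedFunctional V c φ f (s + u) (fun r => X z r ω) ∂P
        - feynmanKac P X V s
            (fun y => ∫ ω, killedFunctional V c φ f u (fun r => X y r ω) ∂P) z|
      ≤ C * Real.exp (c * (s + u : ℝ≥0)) * P.real {ω | exitTime X D z ω ≤ s} := by
  have hF := fun t => isBoundedMeasurable_killedFunctional (c := c) hV.measurable hφ.measurable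
    ⟨hfm, C, hC⟩ t
  have hpath := hX.measurable_path z
  have hwm : Measurable[𝓕 z s] fun ω => weight V c s fun r => X z r ω :=
    @measurable_weight S Ω (𝓕 z s) _ V hV.measurable c s (X z) fun r hr =>
      (hX.adapted z r).mono ((𝓕 z).mono hr) le_rfl
  have hmarkov : feynmanKac P X V s
      (fun y => ∫ ω, killedFunctional V c φ f u (fun r => X y r ω) ∂P) z
      = ∫ ω, weight V c s (fun r => X z r ω)
          * killedFunctional V c φ f u (fun r => X z (s + r) ω) ∂P := by
    rw [hX.markov z s hwm (fun ω => abs_weight_le V c s _) (hF u)]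
    refine integral_congr_ae ?_
    filter_upwards [hX.ae_weight_eq hV hc (hint s)] with ω hω
    simp only [hω]
    ring
  have hshift : Measurable fun ω => fun r => X z (s + r) ω :=
    measurable_pi_lambda _ fun r => hX.measurable z (s + r)
  have hi1 : Integrable (fun ω => killedFunctional V c φ f (s + u) (fun r => X z r ω)) P := by
    obtain ⟨hm, K, hK⟩ := hF (s + u)
    exact Integrable.of_bound (hm.comp hpath).aestronglyMeasurable K (ae_of_all _ fun ω => hK _)
  have hi2 : Integrable (fun ω => weight V c s (fun r => X z r ω)
      * killedFunctional V c φ f u (fun r => X z (s + r) ω)) P := by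
    obtain ⟨hm, K, hK⟩ := hF u
    refine Integrable.of_bound ((hwm.mono ((𝓕 z).le s) le_rfl).mul
      (hm.comp hshift)).aestronglyMeasurable (Real.exp (c * s) * K) (ae_of_all _ fun ω => ?_)
    rw [norm_mul]
    exact mul_le_mul (abs_weight_le V c s _) (hK _) (norm_nonneg _) (Real.exp_pos _).le
  set B : Set Ω := {ω | (fun r => X z r ω) ∉ survival φ s} with hB
  have hBm : MeasurableSet B := (hpath (measurableSet_survival hφ.measurable s)).compl
  have hPB : P.real {ω | exitTime X D z ω ≤ s} = P.real B := by
    refine measureReal_congr ?_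
    filter_upwards [hsurv] with ω hω
    exact propext (not_lt.symm.trans (not_congr hω))
  rw [hmarkov, ← integral_sub hi1 hi2, hPB]
  have hbound : ∀ᵐ ω ∂P, ‖killedFunctional V c φ f (s + u) (fun r => X z r ω)
      - weight V c s (fun r => X z r ω) * killedFunctional V c φ f u (fun r => X z (s + r) ω)‖
      ≤ B.indicator (fun _ => C * Real.exp (c * (s + u : ℝ≥0))) ω := by
    filter_upwards [hX.cadlag z, hint (s + u)] with ω hω hi
    have hadd := hω.weight_add hV hc hi
    have hsplit := hω.mem_survival_add_iff hφ s u
    -- Multiplicativity of the weights reduces the difference to one of survival indicators, which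
    -- vanishes off `B`.
    have hrw : killedFunctional V c φ f (s + u) (fun r => X z r ω)
        - weight V c s (fun r => X z r ω) * killedFunctional V c φ f u (fun r => X z (s + r) ω)
        = f (X z (s + u) ω) * weight V c (s + u) (fun r => X z r ω)
          * ((survival φ (s + u)).indicator 1 (fun r => X z r ω)
            - (survival φ u).indicator 1 (fun r => X z (s + r) ω)) := by
      simp only [killedFunctional, ← hadd]
      ring
    rw [hrw]
    by_cases hBω : ω ∈ B
    · rw [indicator_of_mem hBω, norm_mul, norm_mul]
      have h1 : ‖(survival φ (s + u)).indicator (1 : (ℝ≥0 → S) → ℝ) (fun r => X z r ω)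
          - (survival φ u).indicator 1 (fun r => X z (s + r) ω)‖ ≤ 1 := by
        by_cases ha : (fun r => X z r ω) ∈ survival φ (s + u) <;>
          by_cases hb : (fun r => X z (s + r) ω) ∈ survival φ u <;> simp [ha, hb]
      have hC0 : 0 ≤ C := (abs_nonneg _).trans (hC z)
      calc _ ≤ C * Real.exp (c * (s + u : ℝ≥0)) * 1 := by
            refine mul_le_mul (mul_le_mul (hC _) (abs_weight_le V c _ _) (norm_nonneg _) hC0) h1
              (norm_nonneg _) (by positivity)
        _ = _ := mul_one _
    · have hs : (fun r => X z r ω) ∈ survival φ s := not_not.1 hBω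
      have hiff : (fun r => X z r ω) ∈ survival φ (s + u) ↔
          (fun r => X z (s + r) ω) ∈ survival φ u :=
        hsplit.trans (and_iff_right ((hω.mem_survival_iff hφ s).1 hs).2)
      rw [indicator_of_notMem hBω]
      by_cases hb : (fun r => X z (s + r) ω) ∈ survival φ u
      · simp [hb, hiff.2 hb]
      · simp [hb, mt hiff.1 hb]
  refine (norm_integral_le_of_norm_le ((integrable_const _).indicator hBm) hbound).trans ?_
  rw [integral_indicator_const _ hBm, smul_eq_mul, mul_comm]

/-- The killed Feynman-Kac semigroup is strongly Feller, provided that exits are uniformly unlikely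
in short time on compact subsets of the domain. -/
lemma IsCadlagStrongMarkov.continuous_killedFeynmanKac [BorelSpace S] [LocallyCompactSpace S]
    [IsProbabilityMeasure P] (hX : IsCadlagStrongMarkov P 𝓕 X) (hV : Continuous V)
    (hc : ∀ y, -c ≤ V y)
    (hint : ∀ (z : S) (t : ℝ≥0), ∀ᵐ ω ∂P,
      IntervalIntegrable (fun s : ℝ => V (X z s.toNNReal ω)) volume 0 (t : ℝ))
    (hSF : ∀ t : ℝ≥0, 0 < t → ∀ f : S → ℝ, IsBoundedMeasurable f → Continuous (transition P X t f))
    (hFK : ∀ t : ℝ≥0, 0 < t → ∀ f : S → ℝ, IsBoundedMeasurable f →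
      Continuous (feynmanKac P X V t f))
    (hD : IsOpen D)
    (hB : ∀ K : Set S, IsCompact K → K ⊆ D →
      Tendsto (fun s : ℝ≥0 => ⨆ z ∈ K, P {ω | exitTime X D z ω ≤ s}) (𝓝[>] 0) (𝓝 0))
    {t : ℝ≥0} (ht : 0 < t) {f : D → ℝ} (hf : IsBoundedMeasurable f) :
    Continuous (killedFeynmanKac P X V D t f) := by
  obtain ⟨φ, hφ, hφ0, hφD⟩ := exists_continuous_eq_zero_iff hD
  have hsurv := hX.ae_lt_exitTime_iff hSF hD hφ hφ0 hφD
  obtain ⟨hfm, C, hC⟩ := hf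
  set F : S → ℝ := Function.extend Subtype.val f 0 with hFdef
  have hFm : Measurable F :=
    (MeasurableEmbedding.subtype_coe hD.measurableSet).measurable_extend hfm measurable_zero
  have hFC : ∀ y, |F y| ≤ max C 0 := by
    intro y
    by_cases hy : y ∈ D
    · have : F y = f ⟨y, hy⟩ := Subtype.val_injective.extend_apply f (0 : S → ℝ) ⟨y, hy⟩
      rw [this]
      exact (hC _).trans (le_max_left _ _)
    · have : F y = 0 := Function.extend_apply' f (0 : S → ℝ) y fun ⟨a, ha⟩ => hy (ha ▸ a.2)
      rw [this, abs_zero]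
      exact le_max_right _ _
  set q : ℝ≥0 → S → ℝ := fun r y => ∫ ω, killedFunctional V c φ F r (fun u => X y u ω) ∂P with hq
  have hqb : ∀ r, IsBoundedMeasurable (q r) := by
    intro r
    obtain ⟨hm, K, hK⟩ := isBoundedMeasurable_killedFunctional (c := c) hV.measurable
      hφ.measurable ⟨hFm, _, hFC⟩ r
    refine ⟨hX.measurable_integral hm, K, fun y => ?_⟩
    have := norm_integral_le_of_norm_le_const (μ := P)
      (f := fun ω => killedFunctional V c φ F r (fun u => X y u ω)) (ae_of_all _ fun ω => hK _)
    simpa using this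
  have heq : killedFeynmanKac P X V D t f = fun z : D => q t z := funext fun z =>
    hX.killedFeynmanKac_eq hV hc (hint z t) (hsurv z t) f
  have hcont : ∀ z ∈ D, ContinuousAt (q t) z := by
    intro z hz
    obtain ⟨K, hK, hzK, hKD⟩ := exists_compact_subset hD hz
    -- The error bound is `max C 0 * exp (c t)` times the supremum over `K` of the exit
    -- probabilities before `s`.
    have hunif : TendstoUniformlyOn (fun s : ℝ≥0 => feynmanKac P X V s (q (t - s))) (q t)
        (𝓝[>] 0) K := by
      rw [Metric.tendstoUniformlyOn_iff]
      intro ε hε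
      have hlim : Tendsto (fun s : ℝ≥0 => max C 0 * Real.exp (c * t)
          * (⨆ z ∈ K, P {ω | exitTime X D z ω ≤ s}).toReal) (𝓝[>] 0)
          (𝓝 (max C 0 * Real.exp (c * t) * 0)) :=
        ((ENNReal.tendsto_toReal ENNReal.zero_ne_top).comp (hB K hK hKD)).const_mul _
      rw [mul_zero] at hlim
      have hst : ∀ᶠ s : ℝ≥0 in 𝓝[>] 0, s < t := nhdsWithin_le_nhds (gt_mem_nhds ht)
      filter_upwards [hlim.eventually (gt_mem_nhds hε), hst] with s hs hst y hy
      obtain ⟨u, rfl⟩ := exists_add_of_le hst.le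
      rw [add_tsub_cancel_left, Real.dist_eq]
      refine (hX.abs_sub_feynmanKac_le (D := D) hV hc hφ hFm hFC s u y (hint y)
        (hsurv y s)).trans_lt (lt_of_le_of_lt ?_ hs)
      refine mul_le_mul_of_nonneg_left (ENNReal.toReal_mono ?_ ?_) (by positivity)
      · exact ((iSup₂_le fun _ _ => prob_le_one).trans_lt ENNReal.one_lt_top).ne
      · exact le_iSup₂ (f := fun z (_ : z ∈ K) => P {ω | exitTime X D z ω ≤ s}) y hy
    have hcK : ContinuousOn (q t) K := hunif.continuousOn <| Eventually.frequently <| by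
      filter_upwards [self_mem_nhdsWithin] with s hs
      exact (hFK s hs _ (hqb _)).continuousOn
    exact hcK.continuousAt (mem_interior_iff_mem_nhds.1 hzK)
  rw [heq]
  exact continuous_iff_continuousAt.2 fun z =>
    (hcont z z.2).comp continuous_subtype_val.continuousAt

end Killed

end FeynmanKac

/-! ### The theorem on open subsets of Euclidean space -/

theorem theorem2p6
    (k : ℕ) (hk : 2 ≤ k)
    -- the state space, an open subset of `ℝ^k`
    (M : Set (EuclideanSpace ℝ (Fin k))) (hM : IsOpen M)
    -- the process
    {Ω : Type*} [mΩ : MeasurableSpace Ω] (P : Measure Ω) [IsProbabilityMeasure P]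
    (𝓕 : M → Filtration ℝ≥0 mΩ) (X : M → ℝ≥0 → Ω → M)
    (hX : FeynmanKac.IsCadlagStrongMarkov P 𝓕 X)
    -- the potential
    (V : M → ℝ) (hVcont : Continuous V) (hVbdd : BddBelow (Set.range V))
    (hVint : ∀ (z : M) (t : ℝ≥0), ∀ᵐ ω ∂P,
      IntervalIntegrable (fun s : ℝ => V (X z s.toNNReal ω)) volume 0 (t : ℝ))
    -- the transition semigroup is strongly Feller
    (hSF0 : ∀ t : ℝ≥0, 0 < t → ∀ f : M → ℝ, FeynmanKac.IsBoundedMeasurable f →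
      Continuous (FeynmanKac.transition P X t f))
    -- continuity in probability with respect to the start point
    (hP : ∀ (t : ℝ≥0) (z : M), TendstoInMeasure P (fun z' => X z' t) (𝓝 z) (X z t))
    -- densities with respect to the Lebesgue measure
    (hD : ∀ t : ℝ≥0, 0 < t → ∀ z : M,
      HasPDF (fun ω => (X z t ω : EuclideanSpace ℝ (Fin k))) P volume)
    -- continuity in probability of the integral of the potential
    (hIV : ∀ (t : ℝ≥0) (z : M) (zs : ℕ → M), Tendsto zs atTop (𝓝 z) →
      TendstoInMeasure P (fun n => FeynmanKac.potentialIntegral X V (zs n) t) atTop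
        (FeynmanKac.potentialIntegral X V z t)) :
    (∀ t : ℝ≥0, 0 < t → ∀ f : M → ℝ, FeynmanKac.IsBoundedMeasurable f →
      Continuous (FeynmanKac.feynmanKac P X V t f)) ∧
    -- a subdomain `D` of `M`, on whose compact subsets the exit time is uniformly not small
    ∀ D : Set M, IsOpen D → IsConnected D →
      (∀ K : Set M, IsCompact K → K ⊆ D →
        Tendsto (fun s : ℝ≥0 => ⨆ z ∈ K, P {ω | FeynmanKac.exitTime X D z ω ≤ s})
          (𝓝[>] 0) (𝓝 0)) →
      ∀ t : ℝ≥0, 0 < t → ∀ f : D → ℝ, FeynmanKac.IsBoundedMeasurable f →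
        Continuous (FeynmanKac.killedFeynmanKac P X V D t f) := by
  obtain ⟨b, hb⟩ := hVbdd
  have hc : ∀ y, -(-b) ≤ V y := fun y => by
    rw [neg_neg]
    exact hb (mem_range_self y)
  have hFK : ∀ t : ℝ≥0, 0 < t → ∀ f : M → ℝ, FeynmanKac.IsBoundedMeasurable f →
      Continuous (FeynmanKac.feynmanKac P X V t f) := fun t ht f hf =>
    hX.continuous_feynmanKac hVcont hc (fun z => hVint z t) (hSF0 t ht) (hP t) (hIV t) hf
  have : LocallyCompactSpace M := hM.locallyCompactSpace
  exact ⟨hFK, fun D hDo _ hB t ht f hf =>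
    hX.continuous_killedFeynmanKac hVcont hc hVint hSF0 hFK hDo hB ht hf⟩
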